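/- Let $V=\mathbb C^N$, let $P$ be the flip of $V\otimes V$, and let $q\in\mathbb C\setminus\{0,\pm1\}$ with $q^{2k}\neq1$ for $2\le k\le N$; put $k_q=(q^k-q^{-k})/(q-q^{-1})$. Let $R:V^{\otimes2}\to V^{\otimes 2}$ be a Hecke symmetry, that is, $R_{12}R_{23}R_{12}=R_{23}R_{12}R_{23}$ and $R^2=I+(q-q^{-1})R$. Assume that $R$ is a deformation of $P$: there is a continuous family of Hecke symmetries $R(t)$ with parameters $q(t)\in\mathbb C\setminus\{0\}$, $0\le t\le1$, such that $q(0)=1$, $R(0)=P$, $q(1)=q$, $R(1)=R$, and such that for $t<1$ the parameter is generic: for $2\le k\le N+1$, $q(t)^{2k}=1$ only if $q(t)^2=1$. Assume further that $R$ is skew-invertible, that is, there is an operator $\Psi$ on $V^{\otimes 2}$ with $\mathrm{Tr}_{(2)}R_{12}\Psi_{23}=P_{13}=\mathrm{Tr}_{(2)}\Psi_{12}R_{23}$; put $C=\mathrm{Tr}_{(2)}\Psi_{12}$ and define the $R$-trace by $\mathrm{Tr}_{R(1\dots n)}Y=\mathrm{Tr}\,(C_1\cdots C_n\,Y)$. Write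 $R_k$ for $R$ acting in the factors $k,k+1$ of $V^{\otimes n}$. Let $A^{(1)}=I$ and $A^{(k)}=\frac1{k_q}A^{(k-1)}\bigl(q^{k-1}I-(k-1)_qR_{k-1}\bigr)A^{(k-1)}$ for $k\ge 2$. For a square matrix $X$ of size $N$ put $X_1=X\otimes I$, $X_{\overline1}=X_1$ and $X_{\overline{k+1}}=R_kX_{\overline k}R_k^{-1}$. Consider the unital associative $\mathbb C$-algebra generated by the entries of two $N\times N$ matrices $M$ and $D$ subject to $$R_{12}M_1R_{12}M_1=M_1R_{12}M_1R_{12},\qquad R_{12}^{-1}D_1R_{12}^{-1}D_1=D_1R_{12}^{-1}D_1R_{12}^{-1},$$ $$D_1R_{12}M_1R_{12}=R_{12}M_1R_{12}^{-1}D_1+R_{12},$$ and put $\hat L=MD$. Then $A^{(N)}$ has rank one, and there are $|u\rangle\in V^{\otimes N}$ and $\langle v|\in (V^{\otimes N})^*$ with $A^{(N)}=|u\rangle\langle v|$ and $\langle v|u\rangle=1$. For all such $u$, $v$, with $${\det}_RM=\langle v|M_{\overline1}M_{\overline2}\cdots M_{\overline N}|u\rangle,\qquad {\det}_{R^{-1}}D=\langle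 v|D_{\overline N}\cdots D_{\overline2}D_{\overline1}|u\rangle,$$ the quantum Capelli identity holds: $$\mathrm{Tr}_{R(1\dots N)}\,A^{(N)}\hat L_{\overline1}\bigl(\hat L_{\overline2}+qI\bigr)\cdots\bigl(\hat L_{\overline N}+q^{N-1}(N-1)_qI\bigr)=q^{-N}\,{\det}_RM\;{\det}_{R^{-1}}D .$$ -/

import Mathlib

/-!
Conventions.  `V = ℂ^N`; the space `V^{⊗n}` has the basis indexed by `Fin n → Fin N`, and tensor
factors are numbered from `0` (so the factor called `1` on paper is `0` here).  An operator on
`V ⊗ V` is a matrix indexed by `Fin N × Fin N`.  Matrices may have entries in a noncommutative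
algebra; a product of matrices multiplies the entries in the written order.
-/

namespace Capelli

noncomputable section

variable {N : ℕ} {𝒜 : Type*}

/-- The matrix `X` acting in the `i`-th factor of `V^{⊗n}`. -/
def oneSite [Zero 𝒜] {n : ℕ} (i : Fin n) (X : Matrix (Fin N) (Fin N) 𝒜) :
    Matrix (Fin n → Fin N) (Fin n → Fin N) 𝒜 :=
  Matrix.of fun a b => if ∀ l, l ≠ i → a l = b l then X (a i) (b i) else 0

/-- The matrix `X` acting in the `i`-th and the `j`-th factor of `V^{⊗n}` (`i ≠ j`). -/
def twoSite [Zero 𝒜] {n : ℕ} (i j : Fin n) (X : Matrix (Fin N × Fin N) (Fin N × Fin N) 𝒜) :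
    Matrix (Fin n → Fin N) (Fin n → Fin N) 𝒜 :=
  Matrix.of fun a b =>
    if ∀ l, l ≠ i → l ≠ j → a l = b l then X (a i, a j) (b i, b j) else 0

/-- A numerical matrix regarded as a matrix over a complex algebra. -/
def scalarMat (𝒜 : Type*) [Semiring 𝒜] [Algebra ℂ 𝒜] {ι : Type*} (X : Matrix ι ι ℂ) :
    Matrix ι ι 𝒜 :=
  X.map (algebraMap ℂ 𝒜)

/-- The flip `P (x ⊗ y) = y ⊗ x`. -/
def flip (N : ℕ) : Matrix (Fin N × Fin N) (Fin N × Fin N) ℂ :=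
  Matrix.of fun a b => if a.1 = b.2 ∧ a.2 = b.1 then 1 else 0

/-- `R` satisfies the braid relation and the Hecke condition `R² = I + (q - q⁻¹) R`.
The values `q = ±1` (involutive symmetries) are allowed here. -/
structure IsHeckeSymmetry (q : ℂ) (R : Matrix (Fin N × Fin N) (Fin N × Fin N) ℂ) : Prop where
  ne_zero : q ≠ 0
  braid : twoSite (n := 3) 0 1 R * twoSite 1 2 R * twoSite 0 1 R =
    twoSite 1 2 R * twoSite 0 1 R * twoSite 1 2 R
  hecke : R * R = 1 + (q - q⁻¹) • R

/-- `R` is a deformation of the flip: a continuous family of Hecke symmetries `S t` with parameters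
`p t`, `0 ≤ t ≤ 1`, joins the flip, with the parameter `1`, to `R`, with the parameter `q`.
The parameters before the end of the family are generic: no `q`-integer `k_{p t}`,
`2 ≤ k ≤ N + 1`, vanishes, which means that `(p t)^{2k} = 1` only if `(p t)² = 1`. -/
def IsDeformationOfFlip (q : ℂ) (R : Matrix (Fin N × Fin N) (Fin N × Fin N) ℂ) : Prop :=
  ∃ (p : ℝ → ℂ) (S : ℝ → Matrix (Fin N × Fin N) (Fin N × Fin N) ℂ),
    ContinuousOn p (Set.Icc 0 1) ∧ ContinuousOn S (Set.Icc 0 1) ∧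
    (∀ t ∈ Set.Icc (0 : ℝ) 1, IsHeckeSymmetry (p t) (S t)) ∧
    (∀ t ∈ Set.Ico (0 : ℝ) 1, ∀ k : ℕ, 2 ≤ k → k ≤ N + 1 →
      (p t) ^ (2 * k) = 1 → (p t) ^ 2 = 1) ∧
    p 0 = 1 ∧ S 0 = flip N ∧ p 1 = q ∧ S 1 = R

/-- The `q`-integer `k_q = (q^k - q^{-k}) / (q - q⁻¹)`, for `q ≠ 0, ±1`. -/
def qInt (q : ℂ) (k : ℕ) : ℂ := (q ^ k - (q ^ k)⁻¹) / (q - q⁻¹)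

/-- The `R`-skew-symmetrizer `A^{(k)}` in the first `k` factors of `V^{⊗n}`. -/
def skewSymm (q : ℂ) (R : Matrix (Fin N × Fin N) (Fin N × Fin N) ℂ) (n : ℕ) :
    (k : ℕ) → k ≤ n → Matrix (Fin n → Fin N) (Fin n → Fin N) ℂ
  | 0, _ => 1
  | 1, _ => 1
  | k + 2, h =>
      (qInt q (k + 2))⁻¹ •
        (skewSymm q R n (k + 1) (by omega) *
          (q ^ (k + 1) • (1 : Matrix (Fin n → Fin N) (Fin n → Fin N) ℂ) -
            qInt q (k + 1) • twoSite ⟨k, by omega⟩ ⟨k + 1, by omega⟩ R) *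
          skewSymm q R n (k + 1) (by omega))

/-- `Ψ` is the skew-inverse of `R`: `Tr₂ R₁₂ Ψ₂₃ = P₁₃ = Tr₂ Ψ₁₂ R₂₃`. -/
def IsSkewInverse (R Ψ : Matrix (Fin N × Fin N) (Fin N × Fin N) ℂ) : Prop :=
  (∀ i₁ i₃ j₁ j₃, ∑ a, ∑ b, R (i₁, a) (j₁, b) * Ψ (b, i₃) (a, j₃) = flip N (i₁, i₃) (j₁, j₃)) ∧
  (∀ i₁ i₃ j₁ j₃, ∑ a, ∑ b, Ψ (i₁, a) (j₁, b) * R (b, i₃) (a, j₃) = flip N (i₁, i₃) (j₁, j₃))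

/-- The matrix `C = Tr₂ Ψ₁₂` defining the `R`-trace. -/
def traceMatrix (Ψ : Matrix (Fin N × Fin N) (Fin N × Fin N) ℂ) : Matrix (Fin N) (Fin N) ℂ :=
  Matrix.of fun i j => ∑ a, Ψ (i, a) (j, a)

/-- The `R`-trace `Tr_{R(1…n)} Y = Tr (C₁ ⋯ C_n Y)` over all factors of `V^{⊗n}`, where `Ψ` is the
skew-inverse of `R` and `C = Tr₂ Ψ₁₂`. -/
def rTrace [Semiring 𝒜] [Algebra ℂ 𝒜] (Ψ : Matrix (Fin N × Fin N) (Fin N × Fin N) ℂ) {n : ℕ}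
    (Y : Matrix (Fin n → Fin N) (Fin n → Fin N) 𝒜) : 𝒜 :=
  Matrix.trace
    (scalarMat 𝒜 (Matrix.of fun a b : Fin n → Fin N => ∏ i, traceMatrix Ψ (a i) (b i)) * Y)

/-- The copies `X_{\bar 1} = X_1`, `X_{\overline{k+1}} = R_k X_{\bar k} R_k⁻¹`;
`overlineCopy R X n k` is `X_{\overline{k+1}}` because factors are numbered from `0`. -/
def overlineCopy [Semiring 𝒜] [Algebra ℂ 𝒜] (R : Matrix (Fin N × Fin N) (Fin N × Fin N) ℂ)
    (X : Matrix (Fin N) (Fin N) 𝒜) (n : ℕ) :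
    (k : ℕ) → k < n → Matrix (Fin n → Fin N) (Fin n → Fin N) 𝒜
  | 0, h => oneSite ⟨0, h⟩ X
  | k + 1, h =>
      twoSite ⟨k, by omega⟩ ⟨k + 1, h⟩ (scalarMat 𝒜 R) *
        overlineCopy R X n k (by omega) *
        twoSite ⟨k, by omega⟩ ⟨k + 1, h⟩ (scalarMat 𝒜 R⁻¹)

/-- The generators `m_i^j` and `∂_i^j`. -/
inductive Gen (N : ℕ) : Type
  | m (i j : Fin N) : Gen N
  | d (i j : Fin N) : Gen N

/-- The generating matrix `M` in the free algebra. -/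
def freeM (N : ℕ) : Matrix (Fin N) (Fin N) (FreeAlgebra ℂ (Gen N)) :=
  Matrix.of fun i j => FreeAlgebra.ι ℂ (Gen.m i j)

/-- The generating matrix `D` in the free algebra. -/
def freeD (N : ℕ) : Matrix (Fin N) (Fin N) (FreeAlgebra ℂ (Gen N)) :=
  Matrix.of fun i j => FreeAlgebra.ι ℂ (Gen.d i j)

/-- `M₁` in `V ⊗ V`. -/
abbrev freeM₁ (N : ℕ) := oneSite (n := 2) 0 (freeM N)

/-- `D₁` in `V ⊗ V`. -/
abbrev freeD₁ (N : ℕ) := oneSite (n := 2) 0 (freeD N)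

/-- `X₁₂` in `V ⊗ V`, over the free algebra. -/
abbrev free₁₂ (X : Matrix (Fin N × Fin N) (Fin N × Fin N) ℂ) :=
  twoSite (n := 2) 0 1 (scalarMat (FreeAlgebra ℂ (Gen N)) X)

/-- The defining relations of the quantum double of `𝓓(R⁻¹)` and `𝓜(R)`: the reflection equation
for `M` with `R`, the one for `D` with `R⁻¹`, and the permutation relations. -/
inductive DoubleRel (R : Matrix (Fin N × Fin N) (Fin N × Fin N) ℂ) :
    FreeAlgebra ℂ (Gen N) → FreeAlgebra ℂ (Gen N) → Prop
  | reflM (a b : Fin 2 → Fin N) : DoubleRel R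
      ((free₁₂ R * freeM₁ N * free₁₂ R * freeM₁ N) a b)
      ((freeM₁ N * free₁₂ R * freeM₁ N * free₁₂ R) a b)
  | reflD (a b : Fin 2 → Fin N) : DoubleRel R
      ((free₁₂ R⁻¹ * freeD₁ N * free₁₂ R⁻¹ * freeD₁ N) a b)
      ((freeD₁ N * free₁₂ R⁻¹ * freeD₁ N * free₁₂ R⁻¹) a b)
  | perm (a b : Fin 2 → Fin N) : DoubleRel R
      ((freeD₁ N * free₁₂ R * freeM₁ N * free₁₂ R) a b)
      ((free₁₂ R * freeM₁ N * free₁₂ R⁻¹ * freeD₁ N + free₁₂ R) a b)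

/-- The algebra of the quantum double `(𝓓(R⁻¹), 𝓜(R))`. -/
abbrev QuantumDouble (R : Matrix (Fin N × Fin N) (Fin N × Fin N) ℂ) : Type :=
  RingQuot (DoubleRel R)

/-- The generating matrix `M` of `𝓜(R)` in the quantum double. -/
def matM (R : Matrix (Fin N × Fin N) (Fin N × Fin N) ℂ) :
    Matrix (Fin N) (Fin N) (QuantumDouble R) :=
  (freeM N).map (RingQuot.mkAlgHom ℂ (DoubleRel R))

/-- The generating matrix `D` of `𝓓(R⁻¹)` in the quantum double. -/
def matD (R : Matrix (Fin N × Fin N) (Fin N × Fin N) ℂ) :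
    Matrix (Fin N) (Fin N) (QuantumDouble R) :=
  (freeD N).map (RingQuot.mkAlgHom ℂ (DoubleRel R))

/-- The matrix `\hat L = M D`. -/
def matL (R : Matrix (Fin N × Fin N) (Fin N × Fin N) ℂ) :
    Matrix (Fin N) (Fin N) (QuantumDouble R) :=
  matM R * matD R

/-- `⟨v| Y |u⟩`. -/
def sandwich [Semiring 𝒜] [Algebra ℂ 𝒜] {n : ℕ} (v u : (Fin n → Fin N) → ℂ)
    (Y : Matrix (Fin n → Fin N) (Fin n → Fin N) 𝒜) : 𝒜 :=
  ∑ a, ∑ b, (v a * u b) • Y a b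

/-- `det_R M = ⟨v| M_{\bar 1} M_{\bar 2} ⋯ M_{\bar N} |u⟩`. -/
def detM (R : Matrix (Fin N × Fin N) (Fin N × Fin N) ℂ) (u v : (Fin N → Fin N) → ℂ) :
    QuantumDouble R :=
  sandwich v u (List.ofFn fun k : Fin N => overlineCopy R (matM R) N k k.isLt).prod

/-- `det_{R⁻¹} D = ⟨v| D_{\bar N} ⋯ D_{\bar 2} D_{\bar 1} |u⟩`. -/
def detD (R : Matrix (Fin N × Fin N) (Fin N × Fin N) ℂ) (u v : (Fin N → Fin N) → ℂ) :
    QuantumDouble R :=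
  sandwich v u (List.ofFn fun k : Fin N => overlineCopy R (matD R) N k k.isLt).reverse.prod

/-- `\hat L_{\bar 1} (\hat L_{\bar 2} + q I) ⋯ (\hat L_{\bar N} + q^{N-1} (N-1)_q I)`. -/
def capelliProduct (q : ℂ) (R : Matrix (Fin N × Fin N) (Fin N × Fin N) ℂ) :
    Matrix (Fin N → Fin N) (Fin N → Fin N) (QuantumDouble R) :=
  (List.ofFn fun k : Fin N => overlineCopy R (matL R) N k k.isLt +
    (q ^ (k : ℕ) * qInt q k) •
      (1 : Matrix (Fin N → Fin N) (Fin N → Fin N) (QuantumDouble R))).prod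

end

end Capelli

/-! The statement separates into a matrix identity and the computation of one scalar.

Matrix identity (`IsDouble.capelli`). Let b be a matrix with R_j b = -q⁻¹ b for all j. The
permutation relation lets D_i pass L_k in front of b with a factor q² and a correction -q
(`IsDouble.copy_d_mul_copy_mul`). After i such passages the corrections add up to q + q³ + ⋯ +
q^{2i-1} = q^i i_q, which is exactly the shift in the Capelli product. So that product times b
equals q^{N(N-1)} M_1⋯M_N D_N⋯D_1 b. The antisymmetrizer A = A^{(N)} is such a b: this is the Hecke
algebra fact `IsHeckeRep.mul_skewElem`, proved with the Yang–Baxter equation.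

Trace. A is idempotent and commutes with C^{⊗N}, because R commutes with C ⊗ C
(`IsSkewInverse.commute_traceMatrix`). Hence the R-trace of AY is Tr(C^{⊗N} A Y A). A also commutes
with M_1⋯M_N by the reflection equation, so A M_1⋯M_N D_N⋯D_1 A is the product of two sandwiches
between copies of A. As A = |u⟩⟨v|, this is det M det D times |u⟩⟨v|. The remaining scalar is
q^{N(N-1)} Tr(C^{⊗N} A) = q^{N(N-1)} q^{-N²} = q^{-N}.

The value q^{-N²}. Tracing out the last factor sends 1 to Tr C and R to 1, which gives a recursion
for Tr(C^{⊗k} A^{(k)}) in terms of Tr C. The value Tr C = q^{-N} N_q comes from the vanishing of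
A^{(N)}(q^N - N_q R_N)A^{(N)}, the numerator of A^{(N+1)}.

Deformation. The trace of an idempotent is its rank, so it is constant along a continuous path. At
the flip, A^{(N)} projects onto the line of e_1 ∧ ⋯ ∧ e_N and A^{(N+1)} = 0. This gives rank one for
A^{(N)} at the end of the path, and A^{(N+1)} = 0 before the end. The integer (N+1)_q may vanish at
the end, so there only the numerator passes to the limit. -/

namespace Capelli

/-! ### Conjugated copies in a braid group representation -/

section Braid

variable {E : Type*} [Ring E]

/-- The generators of the braid group on `n` strands, represented by units. -/
structure IsBraidRep (n : ℕ) (T : ℕ → Eˣ) : Prop where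
  braid : ∀ i, i + 2 < n → T i * T (i + 1) * T i = T (i + 1) * T i * T (i + 1)
  comm : ∀ i j, i + 1 < j → j + 1 < n → Commute (T i) (T j)

/-- Conjugation by a unit. -/
def conjHom (u : Eˣ) : E →+* E where
  toFun x := u * x * (u⁻¹ : Eˣ)
  map_one' := by simp
  map_mul' x y := by simp [mul_assoc]
  map_zero' := by simp
  map_add' x y := by simp [mul_add, add_mul]

theorem conjHom_apply (u : Eˣ) (x : E) : conjHom u x = u * x * (u⁻¹ : Eˣ) := rfl

theorem conjHom_eq_self {u : Eˣ} {x : E} (h : Commute (u : E) x) : conjHom u x = x := by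
  rw [conjHom_apply, h.eq, mul_assoc, Units.mul_inv, mul_one]

theorem conjHom_val (u v : Eˣ) : conjHom u (v : E) = ((u * v * u⁻¹ : Eˣ) : E) := rfl

theorem conjHom_mul (u v : Eˣ) (x : E) : conjHom (u * v) x = conjHom u (conjHom v x) := by
  simp [conjHom_apply, mul_assoc]

/-- The copies `x`, `T₀ x T₀⁻¹`, `T₁ T₀ x T₀⁻¹ T₁⁻¹`, … of an element `x`. -/
def copy (T : ℕ → Eˣ) (x : E) : ℕ → E
  | 0 => x
  | k + 1 => T k * copy T x k * ((T k)⁻¹ : Eˣ)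

theorem copy_succ (T : ℕ → Eˣ) (x : E) (k : ℕ) : copy T x (k + 1) = conjHom (T k) (copy T x k) :=
  rfl

theorem copy_mul (T : ℕ → Eˣ) (x y : E) (k : ℕ) :
    copy T (x * y) k = copy T x k * copy T y k := by
  induction k with
  | zero => rfl
  | succ k ih => rw [copy_succ, copy_succ, copy_succ, ih, map_mul]

variable {n : ℕ} {T : ℕ → Eˣ} {x m d : E}

theorem commute_copy_of_lt (hT : IsBraidRep n T)
    (hx : ∀ i, 0 < i → i + 1 < n → Commute (T i : E) x) (k i : ℕ) (hk : k < i) (hi : i + 1 < n) :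
    Commute (T i : E) (copy T x k) := by
  induction k with
  | zero => exact hx i hk hi
  | succ k ih =>
    have h : Commute (T i : E) (T k) := ((hT.comm k i hk hi).symm).units_val
    exact (h.mul_right (ih (by omega))).mul_right h.units_inv_right

/-- The essential case is `k = i + 2`. As `T (i + 1)` fixes copy `i`, copy `i + 2` is its conjugate
by `T (i + 1) * T i * T (i + 1)`. By the braid relation it is then invariant under conjugation by `T
i`. -/
theorem commute_copy_of_add_two_le (hT : IsBraidRep n T)
    (hx : ∀ i, 0 < i → i + 1 < n → Commute (T i : E) x) (k i : ℕ) (hi : i + 2 ≤ k) (hk : k < n) :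
    Commute (T i : E) (copy T x k) := by
  induction k with
  | zero => omega
  | succ k ih =>
    rcases Nat.lt_or_ge i (k - 1) with h | h
    · have h' : Commute (T i : E) (T k) := (hT.comm i k (by omega) hk).units_val
      exact (h'.mul_right (ih (by omega) (by omega))).mul_right h'.units_inv_right
    · obtain rfl : k = i + 1 := by omega
      have hb := hT.braid i (by omega)
      have hc := commute_copy_of_lt hT hx i (i + 1) (by omega) hk
      have e : copy T x (i + 1 + 1) = conjHom (T i * T (i + 1) * T i) (copy T x i) := by
        rw [hb, conjHom_mul, conjHom_mul, conjHom_eq_self hc]; rfl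
      have e' : conjHom (T i) (copy T x (i + 1 + 1)) = copy T x (i + 1 + 1) := by
        conv_rhs => rw [e, mul_assoc, conjHom_mul, conjHom_mul]
        rfl
      rw [conjHom_apply] at e'
      have := congrArg (· * (T i : E)) e'
      exact show _ = _ by simpa [mul_assoc] using this

/-- Conjugation by `T k * T (k + 1)` raises both copies and generators by one index, so relations
known for index 0 spread to every index. -/
theorem conjHom_copy (hT : IsBraidRep n T)
    (hx : ∀ i, 0 < i → i + 1 < n → Commute (T i : E) x) (k : ℕ) (hk : k + 2 < n) :
    conjHom (T k * T (k + 1)) (copy T x k) = copy T x (k + 1) := by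
  rw [conjHom_mul, conjHom_eq_self (commute_copy_of_lt hT hx k (k + 1) (by omega) hk)]
  rfl

theorem conj_generator (hT : IsBraidRep n T) (k : ℕ) (hk : k + 2 < n) :
    T k * T (k + 1) * T k * (T k * T (k + 1))⁻¹ = T (k + 1) := by
  rw [hT.braid k hk, mul_assoc (T (k + 1)), mul_inv_cancel_right]

theorem conjHom_generator (hT : IsBraidRep n T) (k : ℕ) (hk : k + 2 < n) :
    conjHom (T k * T (k + 1)) (T k : E) = T (k + 1) := by
  rw [conjHom_val, conj_generator hT k hk]

theorem conjHom_generator_inv (hT : IsBraidRep n T) (k : ℕ) (hk : k + 2 < n) :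
    conjHom (T k * T (k + 1)) ((T k)⁻¹ : Eˣ) = ((T (k + 1))⁻¹ : Eˣ) := by
  rw [conjHom_val, ← conj_inv, conj_generator hT k hk]

theorem refl_copy (hT : IsBraidRep n T) (hm : ∀ i, 0 < i → i + 1 < n → Commute (T i : E) m)
    (h : 1 < n → (T 0 : E) * m * T 0 * m = m * T 0 * m * T 0) (k : ℕ) (hk : k + 1 < n) :
    (T k : E) * copy T m k * T k * copy T m k = copy T m k * T k * copy T m k * T k := by
  induction k with
  | zero => exact h hk
  | succ k ih =>
    have := congrArg (conjHom (T k * T (k + 1))) (ih (by omega))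
    simpa only [map_mul, conjHom_copy hT hm k hk, conjHom_generator hT k hk] using this

theorem refl_inv_copy (hT : IsBraidRep n T) (hd : ∀ i, 0 < i → i + 1 < n → Commute (T i : E) d)
    (h : 1 < n → ((T 0)⁻¹ : Eˣ) * d * ((T 0)⁻¹ : Eˣ) * d = d * ((T 0)⁻¹ : Eˣ) * d * ((T 0)⁻¹ : Eˣ))
    (k : ℕ) (hk : k + 1 < n) :
    ((T k)⁻¹ : Eˣ) * copy T d k * ((T k)⁻¹ : Eˣ) * copy T d k =
      copy T d k * ((T k)⁻¹ : Eˣ) * copy T d k * ((T k)⁻¹ : Eˣ) := by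
  induction k with
  | zero => exact h hk
  | succ k ih =>
    have := congrArg (conjHom (T k * T (k + 1))) (ih (by omega))
    simpa only [map_mul, conjHom_copy hT hd k hk, conjHom_generator_inv hT k hk] using this

theorem perm_copy (hT : IsBraidRep n T) (hm : ∀ i, 0 < i → i + 1 < n → Commute (T i : E) m)
    (hd : ∀ i, 0 < i → i + 1 < n → Commute (T i : E) d)
    (h : 1 < n → d * T 0 * m * T 0 = T 0 * m * ((T 0)⁻¹ : Eˣ) * d + T 0)
    (k : ℕ) (hk : k + 1 < n) :
    copy T d k * T k * copy T m k * T k =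
      T k * copy T m k * ((T k)⁻¹ : Eˣ) * copy T d k + T k := by
  induction k with
  | zero => exact h hk
  | succ k ih =>
    have := congrArg (conjHom (T k * T (k + 1))) (ih (by omega))
    simpa only [map_mul, map_add, conjHom_copy hT hd k hk, conjHom_copy hT hm k hk,
      conjHom_generator hT k hk, conjHom_generator_inv hT k hk] using this

/-- This is the reflection equation, multiplied on the right by the inverse of `T k`. -/
theorem commute_copy_mul_copy_succ (hT : IsBraidRep n T)
    (hm : ∀ i, 0 < i → i + 1 < n → Commute (T i : E) m)
    (h : 1 < n → (T 0 : E) * m * T 0 * m = m * T 0 * m * T 0) (k : ℕ) (hk : k + 1 < n) :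
    Commute (T k : E) (copy T m k * copy T m (k + 1)) := by
  have := refl_copy hT hm h k hk
  change (T k : E) * (copy T m k * (T k * copy T m k * ((T k)⁻¹ : Eˣ))) =
    copy T m k * (T k * copy T m k * ((T k)⁻¹ : Eˣ)) * T k
  have := congrArg (· * (((T k)⁻¹ : Eˣ) : E)) this
  simpa [mul_assoc] using this

theorem commute_copy_succ_mul_copy (hT : IsBraidRep n T)
    (hd : ∀ i, 0 < i → i + 1 < n → Commute (T i : E) d)
    (h : 1 < n → ((T 0)⁻¹ : Eˣ) * d * ((T 0)⁻¹ : Eˣ) * d = d * ((T 0)⁻¹ : Eˣ) * d * ((T 0)⁻¹ : Eˣ))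
    (k : ℕ) (hk : k + 1 < n) :
    Commute (T k : E) (copy T d (k + 1) * copy T d k) := by
  have := refl_inv_copy hT hd h k hk
  change (T k : E) * ((T k * copy T d k * ((T k)⁻¹ : Eˣ)) * copy T d k) =
    (T k * copy T d k * ((T k)⁻¹ : Eˣ)) * copy T d k * T k
  have := congrArg (fun z => (T k : E) * (T k * z) * (T k : E)) this
  simpa [mul_assoc] using this.symm

/-- The increasing product `f 0 * f 1 * ⋯ * f (k - 1)`. -/
def incProd (f : ℕ → E) : ℕ → E
  | 0 => 1
  | k + 1 => incProd f k * f k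

/-- The decreasing product `f (k - 1) * ⋯ * f 1 * f 0`. -/
def decProd (f : ℕ → E) : ℕ → E
  | 0 => 1
  | k + 1 => f k * decProd f k

/-- Copies `i` and `i + 1` lie both inside or both outside the product, except when `i + 1 = k`.
Inside, the pair commutes with `T i` as a whole, although its two members need not. -/
theorem commute_incProd (hT : IsBraidRep n T)
    (hm : ∀ i, 0 < i → i + 1 < n → Commute (T i : E) m)
    (h : 1 < n → (T 0 : E) * m * T 0 * m = m * T 0 * m * T 0) (k i : ℕ) (hi : i + 1 < n)
    (hk : k ≤ n) (hik : i + 1 ≠ k) : Commute (T i : E) (incProd (copy T m) k) := by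
  induction k using Nat.strong_induction_on with
  | _ k ih =>
    match k with
    | 0 => exact Commute.one_right _
    | k + 1 =>
      rcases Nat.lt_trichotomy (i + 1) k with h1 | h1 | h1
      · exact (ih k (by omega) (by omega) (by omega)).mul_right
          (commute_copy_of_add_two_le hT hm k i (by omega) (by omega))
      · subst h1
        have := (ih i (by omega) (by omega) (by omega)).mul_right
          (commute_copy_mul_copy_succ hT hm h i (by omega))
        rwa [← mul_assoc] at this
      · exact (ih k (by omega) (by omega) (by omega)).mul_right
          (commute_copy_of_lt hT hm k i (by omega) (by omega))

theorem commute_decProd (hT : IsBraidRep n T)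
    (hd : ∀ i, 0 < i → i + 1 < n → Commute (T i : E) d)
    (h : 1 < n → ((T 0)⁻¹ : Eˣ) * d * ((T 0)⁻¹ : Eˣ) * d = d * ((T 0)⁻¹ : Eˣ) * d * ((T 0)⁻¹ : Eˣ))
    (k i : ℕ) (hi : i + 1 < n) (hk : k ≤ n) (hik : i + 1 ≠ k) :
    Commute (T i : E) (decProd (copy T d) k) := by
  induction k using Nat.strong_induction_on with
  | _ k ih =>
    match k with
    | 0 => exact Commute.one_right _
    | k + 1 =>
      rcases Nat.lt_trichotomy (i + 1) k with h1 | h1 | h1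
      · exact (commute_copy_of_add_two_le hT hd k i (by omega) (by omega)).mul_right
          (ih k (by omega) (by omega) (by omega))
      · subst h1
        have := (commute_copy_succ_mul_copy hT hd h i (by omega)).mul_right
          (ih i (by omega) (by omega) (by omega))
        rwa [mul_assoc] at this
      · exact (commute_copy_of_lt hT hd k i (by omega) (by omega)).mul_right
          (ih k (by omega) (by omega) (by omega))

end Braid

/-! ### Relations of the quantum double at all indices -/

section Double

variable {E : Type*} [Ring E] {n : ℕ} {T : ℕ → Eˣ} {m d : E}

/-- The relations of the quantum double for `m = M₁`, `d = D₁` in the algebra of matrices of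
`V^{⊗n}`, where `T i` is the Hecke symmetry in the factors `i`, `i + 1`. -/
structure IsDouble (n : ℕ) (T : ℕ → Eˣ) (m d : E) : Prop where
  rep : IsBraidRep n T
  comm_m : ∀ i, 0 < i → i + 1 < n → Commute (T i : E) m
  comm_d : ∀ i, 0 < i → i + 1 < n → Commute (T i : E) d
  refl_m : 1 < n → (T 0 : E) * m * T 0 * m = m * T 0 * m * T 0
  refl_d : 1 < n →
    ((T 0)⁻¹ : Eˣ) * d * ((T 0)⁻¹ : Eˣ) * d = d * ((T 0)⁻¹ : Eˣ) * d * ((T 0)⁻¹ : Eˣ)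
  perm : 1 < n → d * T 0 * m * T 0 = T 0 * m * ((T 0)⁻¹ : Eˣ) * d + T 0

theorem IsDouble.copy_d_mul_copy_m (h : IsDouble n T m d) (k : ℕ) (hk : k + 1 < n) :
    copy T d k * copy T m (k + 1) =
      copy T m (k + 1) * copy T d k * ((T k)⁻¹ : Eˣ) * ((T k)⁻¹ : Eˣ) + ((T k)⁻¹ : Eˣ) := by
  have := congrArg (· * ((((T k)⁻¹ : Eˣ) : E) * (((T k)⁻¹ : Eˣ) : E)))
    (perm_copy h.rep h.comm_m h.comm_d h.perm k hk)
  simp only [add_mul] at this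
  simpa [mul_assoc, copy] using this

theorem IsDouble.commute_mul (h : IsDouble n T m d) (i : ℕ) (h0 : 0 < i) (hi : i + 1 < n) :
    Commute (T i : E) (m * d) :=
  (h.comm_m i h0 hi).mul_right (h.comm_d i h0 hi)

end Double

/-! ### The matrix Capelli identity -/

section Capelli

variable {E : Type*} [Ring E] [Algebra ℂ E] {n : ℕ} {T : ℕ → Eˣ} {m d : E} {q : ℂ}

theorem units_inv_mul_of_eigen (hq : q ≠ 0) {u : Eˣ} {b : E} (h : (u : E) * b = (-q⁻¹) • b) :
    ((u⁻¹ : Eˣ) : E) * b = (-q) • b := by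
  have : ((u⁻¹ : Eˣ) : E) * (u * b) = (-q⁻¹) • (((u⁻¹ : Eˣ) : E) * b) := by
    rw [h, mul_smul_comm]
  rw [← mul_assoc, Units.inv_mul, one_mul] at this
  nth_rewrite 2 [this]
  rw [smul_smul]
  simp [hq]

/-- Moving `D_i` through `L_k = M_k D_k`, in front of an antisymmetric element. -/
theorem IsDouble.copy_d_mul_copy_mul (h : IsDouble n T m d) (hq : q ≠ 0) (i k : ℕ) (hik : i < k)
    (hk : k < n) (b : E) (hb : ∀ j, j < k → (T j : E) * b = (-q⁻¹) • b) :
    copy T d i * copy T (m * d) k * decProd (copy T d) i * b =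
      q ^ 2 • (copy T (m * d) k * decProd (copy T d) (i + 1) * b) -
        q • (decProd (copy T d) (i + 1) * b) := by
  induction k, hik using Nat.le_induction with
  -- For adjacent indices the permutation relation applies. Every inverse of `T i` is moved right to
  -- `P * b`, where it acts as `-q`; two of them give `q ^ 2`.
  | base =>
    have hb' := units_inv_mul_of_eigen hq (hb i (by omega))
    have hc := (commute_decProd h.rep h.comm_d h.refl_d i i hk (by omega) (by omega)).units_inv_left
    have hc2 := (commute_copy_succ_mul_copy h.rep h.comm_d h.refl_d i hk).units_inv_left
    set P := decProd (copy T d) i with hP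
    set D := copy T d i with hD
    have hs : decProd (copy T d) (i + 1) = D * P := rfl
    have hPb : (((T i)⁻¹ : Eˣ) : E) * (P * b) = (-q) • (P * b) := by
      rw [← mul_assoc, hc.eq, mul_assoc, hb', mul_smul_comm]
    have hTD : (((T i)⁻¹ : Eˣ) : E) * copy T d (i + 1) = D * ((T i)⁻¹ : Eˣ) := by
      simp [copy, ← mul_assoc, hD]
    have hDD : D * (((T i)⁻¹ : Eˣ) : E) * D = copy T d (i + 1) * D * ((T i)⁻¹ : Eˣ) := by
      rw [← hTD, mul_assoc, hc2.eq]
    rw [copy_mul, ← mul_assoc, h.copy_d_mul_copy_m i hk, hs, ← hD]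
    have e1 : (copy T m (i + 1) * D * ((T i)⁻¹ : Eˣ) * ((T i)⁻¹ : Eˣ) + ((T i)⁻¹ : Eˣ)) *
        copy T d (i + 1) * P * b =
        copy T m (i + 1) * (D * ((T i)⁻¹ : Eˣ)) * (((T i)⁻¹ : Eˣ) * copy T d (i + 1)) * (P * b) +
          (((T i)⁻¹ : Eˣ) * copy T d (i + 1)) * (P * b) := by
      simp only [add_mul, mul_assoc]
    have e2 : copy T m (i + 1) * (D * ((T i)⁻¹ : Eˣ)) * (D * ((T i)⁻¹ : Eˣ)) * (P * b) =
        copy T m (i + 1) * (D * ((T i)⁻¹ : Eˣ) * D) * (((T i)⁻¹ : Eˣ) * (P * b)) := by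
      simp only [mul_assoc]
    rw [e1, hTD, e2, hPb, hDD]
    have e3 : copy T m (i + 1) * (copy T d (i + 1) * D * ((T i)⁻¹ : Eˣ)) * ((-q) • (P * b)) =
        (-q) • (copy T m (i + 1) * (copy T d (i + 1) * D) * (((T i)⁻¹ : Eˣ) * (P * b))) := by
      simp only [mul_assoc, mul_smul_comm]
    rw [e3, hPb, mul_assoc D _ (P * b), hPb]
    simp only [mul_smul_comm, smul_smul, mul_assoc]
    module
  -- Here `T k` commutes with all the copies of `d` involved, so the conjugation that raises the
  -- copy of `m * d` can be pulled out to both ends. On the right it meets `b` and gives `-q`.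
  | succ k hik ih =>
    have hik' : i < k := hik
    have hb0 := hb k (by omega)
    have hb' := units_inv_mul_of_eigen hq hb0
    have ih := ih (by omega) (fun j hj => hb j (by omega))
    have c0 := commute_copy_of_lt h.rep h.comm_d i k hik' hk
    have c1 := commute_decProd h.rep h.comm_d h.refl_d i k hk (by omega) (by omega)
    have c2 := commute_decProd h.rep h.comm_d h.refl_d (i + 1) k hk (by omega) (by omega)
    rw [copy_succ, conjHom_apply]
    set P := decProd (copy T d) i
    set P' := decProd (copy T d) (i + 1)
    set L := copy T (m * d) k
    have e1 : copy T d i * (T k * L * ((T k)⁻¹ : Eˣ)) * P * b =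
        (-q) • (T k * (copy T d i * L * P * b)) := by
      calc _ = (copy T d i * T k) * L * (((T k)⁻¹ : Eˣ) * P) * b := by simp only [mul_assoc]
        _ = (T k * copy T d i) * L * (P * ((T k)⁻¹ : Eˣ)) * b := by
          rw [c0.eq, c1.units_inv_left.eq]
        _ = T k * copy T d i * L * P * (((T k)⁻¹ : Eˣ) * b) := by simp only [mul_assoc]
        _ = _ := by rw [hb']; simp only [mul_assoc, mul_smul_comm]
    have e2 : T k * L * ((T k)⁻¹ : Eˣ) * P' * b = (-q) • (T k * (L * P' * b)) := by
      calc _ = T k * L * (((T k)⁻¹ : Eˣ) * P') * b := by simp only [mul_assoc]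
        _ = T k * L * P' * (((T k)⁻¹ : Eˣ) * b) := by
          rw [c2.units_inv_left.eq]; simp only [mul_assoc]
        _ = _ := by rw [hb']; simp only [mul_assoc, mul_smul_comm]
    have e3 : P' * b = (-q) • (T k * (P' * b)) := by
      rw [← mul_assoc, c2.eq, mul_assoc, hb0, mul_smul_comm, smul_smul]
      simp [hq]
    rw [e1, ih, e2]
    nth_rewrite 2 [e3]
    simp only [mul_sub, mul_smul_comm]
    module

/-- Passage number `i` contributes `q` times the factor `q ^ (2 * i)` already collected, whence the
recursion for `c`. -/
theorem IsDouble.decProd_mul_copy_mul (h : IsDouble n T m d) (hq : q ≠ 0) (c : ℕ → ℂ)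
    (hc0 : c 0 = 0) (hc : ∀ k, c (k + 1) = c k + q ^ (2 * k + 1)) (i k : ℕ) (hik : i ≤ k)
    (hk : k < n) (b : E) (hb : ∀ j, j < k → (T j : E) * b = (-q⁻¹) • b) :
    decProd (copy T d) i * copy T (m * d) k * b =
      q ^ (2 * i) • (copy T (m * d) k * decProd (copy T d) i * b) -
        c i • (decProd (copy T d) i * b) := by
  induction i with
  | zero => simp [decProd, hc0]
  | succ i ih =>
    have e : decProd (copy T d) (i + 1) * copy T (m * d) k * b =
      copy T d i * (decProd (copy T d) i * copy T (m * d) k * b) := by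
      simp only [decProd, mul_assoc]
    have h2 := h.copy_d_mul_copy_mul hq i k (by omega) hk b hb
    have e2 : copy T d i * (copy T (m * d) k * decProd (copy T d) i * b) =
      copy T d i * copy T (m * d) k * decProd (copy T d) i * b := by simp only [mul_assoc]
    have e3 : copy T d i * (decProd (copy T d) i * b) = decProd (copy T d) (i + 1) * b := by
      simp only [decProd, mul_assoc]
    rw [e, ih (by omega), mul_sub, mul_smul_comm, mul_smul_comm, e2, h2, e3, hc]
    module

/-- The matrix Capelli identity, in front of an antisymmetric element. -/
theorem IsDouble.capelli (h : IsDouble n T m d) (hq : q ≠ 0) (c : ℕ → ℂ)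
    (hc0 : c 0 = 0) (hc : ∀ k, c (k + 1) = c k + q ^ (2 * k + 1)) (k : ℕ) (hk : k ≤ n) (b : E)
    (hb : ∀ j, j + 1 < k → (T j : E) * b = (-q⁻¹) • b) :
    incProd (fun j => copy T (m * d) j + c j • 1) k * b =
      q ^ (k * (k - 1)) • (incProd (copy T m) k * decProd (copy T d) k * b) := by
  induction k generalizing b with
  | zero => simp [incProd, decProd]
  | succ k ih =>
    -- The last factor is absorbed into `b`: it commutes with the lower generators, so antisymmetry
    -- for them survives. This is why the induction runs over all `b`.
    have hb1 : ∀ j, j + 1 < k → (T j : E) * ((copy T (m * d) k + c k • 1) * b) =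
        (-q⁻¹) • ((copy T (m * d) k + c k • 1) * b) := by
      intro j hj
      have hcm : Commute (T j : E) (copy T (m * d) k + c k • 1) :=
        (commute_copy_of_add_two_le h.rep h.commute_mul k j (by omega) (by omega)).add_right
          ((Commute.one_right _).smul_right _)
      rw [← mul_assoc, hcm.eq, mul_assoc, hb j (by omega), mul_smul_comm]
    have h2 := h.decProd_mul_copy_mul hq c hc0 hc k k le_rfl (by omega) b
      fun j hj => hb j (by omega)
    have e1 : incProd (fun j => copy T (m * d) j + c j • 1) (k + 1) * b =
      incProd (fun j => copy T (m * d) j + c j • 1) k * ((copy T (m * d) k + c k • 1) * b) := by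
      simp only [incProd, mul_assoc]
    have e2 : incProd (copy T m) k * decProd (copy T d) k * ((copy T (m * d) k + c k • 1) * b) =
      incProd (copy T m) k * (decProd (copy T d) k * copy T (m * d) k * b +
        c k • (decProd (copy T d) k * b)) := by
      simp only [mul_add, add_mul, mul_assoc, smul_mul_assoc, one_mul, mul_smul_comm]
    have e3 : incProd (copy T m) (k + 1) * decProd (copy T d) (k + 1) * b =
      incProd (copy T m) k * (copy T (m * d) k * decProd (copy T d) k * b) := by
      simp only [incProd, decProd, copy_mul, mul_assoc]
    have e4 : (k + 1) * (k + 1 - 1) = k * (k - 1) + 2 * k := by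
      cases k with
      | zero => rfl
      | succ k => simp; ring
    rw [e1, ih (by omega) _ hb1, e2, h2, sub_add_cancel, e3, mul_smul_comm, smul_smul, e4, pow_add]

end Capelli

/-! ### Antisymmetrizers in the Hecke algebra -/

section Skew

variable {E : Type*} [Ring E] [Algebra ℂ E]

/-- The antisymmetrizers of a representation `T` of the Hecke algebra; `c k` is the `q`-integer
`k_q`. -/
noncomputable def skewElem (q : ℂ) (c : ℕ → ℂ) (T : ℕ → E) : ℕ → E
  | 0 => 1
  | 1 => 1
  | k + 2 => (c (k + 2))⁻¹ • (skewElem q c T (k + 1) *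
      (q ^ (k + 1) • 1 - c (k + 1) • T k) * skewElem q c T (k + 1))

/-- A representation of the Hecke algebra `H_n(q)`. -/
structure IsHeckeRep (n : ℕ) (q : ℂ) (T : ℕ → E) : Prop where
  braid : ∀ i, i + 2 < n → T i * T (i + 1) * T i = T (i + 1) * T i * T (i + 1)
  comm : ∀ i j, i + 1 < j → j + 1 < n → Commute (T i) (T j)
  hecke : ∀ i, i + 1 < n → T i * T i = 1 + (q - q⁻¹) • T i

variable {n : ℕ} {q : ℂ} {c : ℕ → ℂ} {T : ℕ → E}

/-- The Yang–Baxter equation for the Baxterized elements q^k - k_q x, at the parameters -1, k, k +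
1; since (-1)_q = -1, the parameter -1 gives x + q⁻¹. -/
theorem baxter_left {x y : E} (hq : q ≠ 0) (hb : x * y * x = y * x * y)
    (hx : x * x = 1 + (q - q⁻¹) • x) (hy : y * y = 1 + (q - q⁻¹) • y) (k : ℕ)
    (hc : c (k + 1) = q ^ k + q⁻¹ * c k) :
    (x + q⁻¹ • 1) * (q ^ k • 1 - c k • y) * (q ^ (k + 1) • 1 - c (k + 1) • x) =
      (q ^ (k + 1) • 1 - c (k + 1) • y) * (q ^ k • 1 - c k • x) * (y + q⁻¹ • 1) := by
  simp only [mul_add, add_mul, mul_sub, sub_mul, smul_mul_assoc, mul_smul_comm, one_mul, mul_one,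
    smul_add, smul_sub, smul_smul, hb, hx, hy, hc, pow_succ]
  match_scalars <;> field_simp <;> ring

theorem commute_skewElem {x : E} (k : ℕ) (h : ∀ i, i + 1 < k → Commute x (T i)) :
    Commute x (skewElem q c T k) := by
  induction k with
  | zero => exact Commute.one_right _
  | succ k ih =>
    cases k with
    | zero => exact Commute.one_right _
    | succ k =>
      have := ih fun i hi => h i (by omega)
      exact ((this.mul_right (((Commute.one_right _).smul_right _).sub_right
        ((h k (by omega)).smul_right _))).mul_right this).smul_right _

/-- On `b` the middle factor acts as q^{k+1} + q⁻¹ (k+1)_q = (k+2)_q, which the normalization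
cancels. -/
theorem skewElem_mul_of_eigen {b : E}
    (hc : ∀ k, c (k + 1) = q ^ k + q⁻¹ * c k) (k : ℕ) (hck : ∀ j, 2 ≤ j → j ≤ k → c j ≠ 0)
    (hb : ∀ i, i + 1 < k → T i * b = (-q⁻¹) • b) : skewElem q c T k * b = b := by
  induction k with
  | zero => simp [skewElem]
  | succ k ih =>
    cases k with
    | zero => simp [skewElem]
    | succ k =>
      have h1 := ih (fun j h2 hj => hck j h2 (by omega)) fun i hi => hb i (by omega)
      have h2 : (q ^ (k + 1) • (1 : E) - c (k + 1) • T k) * b = c (k + 2) • b := by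
        rw [sub_mul, smul_mul_assoc, smul_mul_assoc, one_mul, hb k (by omega), hc (k + 1)]
        module
      rw [skewElem, smul_mul_assoc, mul_assoc, h1, mul_assoc, h2, mul_smul_comm, h1, smul_smul,
        inv_mul_cancel₀ (hck _ (by omega) (by omega)), one_smul]

/-- Only the top generator needs an argument. After unfolding the left antisymmetrizer,
`baxter_left` carries the factor T + q⁻¹ to the right with its index lowered by one, where it
annihilates the right antisymmetrizer by induction. -/
theorem IsHeckeRep.mul_skewElem (h : IsHeckeRep n q T) (hq : q ≠ 0) (hc0 : c 1 = 1)
    (hc : ∀ k, c (k + 1) = q ^ k + q⁻¹ * c k) (k : ℕ) (hk : k ≤ n)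
    (hck : ∀ j, 2 ≤ j → j ≤ k → c j ≠ 0) (i : ℕ) (hi : i + 1 < k) :
    T i * skewElem q c T k = (-q⁻¹) • skewElem q c T k := by
  induction k generalizing i with
  | zero => omega
  | succ k ih =>
    have ih2 := ih (by omega) fun j h2 hj => hck j h2 (by omega)
    match k with
    | 0 => omega
    | k + 1 =>
      rcases Nat.lt_or_ge i k with h1 | h1
      · rw [skewElem, mul_smul_comm, ← mul_assoc, ← mul_assoc, ih2 i (by omega), smul_mul_assoc,
          smul_mul_assoc, smul_comm]
      · obtain rfl : i = k := by omega
        have key : (T i + q⁻¹ • 1) * (skewElem q c T (i + 1) *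
            (q ^ (i + 1) • 1 - c (i + 1) • T i) * skewElem q c T (i + 1)) = 0 := by
          match i with
          | 0 =>
            have hh := h.hecke 0 (by omega)
            simp only [skewElem, hc0, mul_sub, add_mul, smul_mul_assoc, mul_smul_comm,
              one_mul, mul_one, hh, smul_add]
            match_scalars <;> field_simp <;> ring
          | j + 1 =>
            have hA := commute_skewElem (q := q) (c := c) (T := T) (x := T (j + 1)) (j + 1)
              fun i hi => (h.comm i (j + 1) (by omega) (by omega)).symm
            have hbx := baxter_left hq (h.braid j (by omega)).symm (h.hecke (j + 1) (by omega))
              (h.hecke j (by omega)) (j + 1) (hc (j + 1))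
            have habs : (T j + q⁻¹ • 1) * skewElem q c T (j + 2) = 0 := by
              rw [add_mul, ih2 j (by omega), smul_mul_assoc, one_mul]; module
            have hAA : skewElem q c T (j + 1) * skewElem q c T (j + 2) = skewElem q c T (j + 2) :=
              skewElem_mul_of_eigen hc (j + 1) (fun l h2 hl => hck l h2 (by omega))
                fun i hi => ih2 i (by omega)
            have hA1 : Commute (T (j + 1) + q⁻¹ • 1) (skewElem q c T (j + 1)) :=
              hA.add_left ((Commute.one_left _).smul_left _)
            have hA2 : Commute (skewElem q c T (j + 1))
                (q ^ (j + 1 + 1) • 1 - c (j + 1 + 1) • T (j + 1)) :=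
              ((Commute.one_right _).smul_right _).sub_right (hA.symm.smul_right _)
            -- Only the left occurrence is expanded; the right one must stay whole to be
            -- annihilated.
            nth_rewrite 1 [skewElem]
            rw [smul_mul_assoc, smul_mul_assoc, mul_smul_comm]
            generalize skewElem q c T (j + 2) = A at *
            generalize skewElem q c T (j + 1) = B at *
            generalize q ^ (j + 1 + 1) • (1 : E) - c (j + 1 + 1) • T (j + 1) = X at *
            generalize q ^ (j + 1) • (1 : E) - c (j + 1) • T j = Y at *
            generalize T (j + 1) + q⁻¹ • 1 = Z at *
            have : Z * (B * Y * B * X * A) = B * (Z * Y * X) * (B * A) := by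
              calc _ = (Z * B) * Y * (B * X) * A := by simp only [mul_assoc]
                _ = _ := by rw [hA1.eq, hA2.eq]; simp only [mul_assoc]
            rw [this, hbx, hAA, mul_assoc, mul_assoc, habs, mul_zero, mul_zero, smul_zero]
        rw [skewElem, mul_smul_comm, smul_comm, ← sub_eq_zero, ← smul_sub]
        rw [add_mul, smul_mul_assoc, one_mul] at key
        rw [neg_smul, sub_neg_eq_add, key, smul_zero]

theorem IsHeckeRep.skewElem_mul_self (h : IsHeckeRep n q T) (hq : q ≠ 0) (hc0 : c 1 = 1)
    (hc : ∀ k, c (k + 1) = q ^ k + q⁻¹ * c k) (k : ℕ) (hk : k ≤ n)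
    (hck : ∀ j, 2 ≤ j → j ≤ k → c j ≠ 0) :
    skewElem q c T k * skewElem q c T k = skewElem q c T k :=
  skewElem_mul_of_eigen hc k hck (h.mul_skewElem hq hc0 hc k hk hck)

/-- The recursive expression is a palindrome, so right-hand statements follow from left-hand ones in
the opposite ring. -/
theorem op_skewElem (k : ℕ) : MulOpposite.op (skewElem q c T k) =
    skewElem q c (fun i => MulOpposite.op (T i)) k := by
  induction k with
  | zero => rfl
  | succ k ih =>
    cases k with
    | zero => rfl
    | succ k => simp only [skewElem, ← ih, ← mul_assoc, MulOpposite.op_smul, MulOpposite.op_mul,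
        MulOpposite.op_sub, MulOpposite.op_one]

theorem IsHeckeRep.skewElem_mul (h : IsHeckeRep n q T) (hq : q ≠ 0) (hc0 : c 1 = 1)
    (hc : ∀ k, c (k + 1) = q ^ k + q⁻¹ * c k) (k : ℕ) (hk : k ≤ n)
    (hck : ∀ j, 2 ≤ j → j ≤ k → c j ≠ 0) (i : ℕ) (hi : i + 1 < k) :
    skewElem q c T k * T i = (-q⁻¹) • skewElem q c T k := by
  have h' : IsHeckeRep n q fun i => MulOpposite.op (T i) :=
    { braid := fun i hi => by
        simpa only [← MulOpposite.op_mul, mul_assoc] using congrArg MulOpposite.op (h.braid i hi)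
      comm := fun i j hij hj => (h.comm i j hij hj).op
      hecke := fun i hi => by
        rw [← MulOpposite.op_mul, h.hecke i hi]
        rfl }
  have := h'.mul_skewElem hq hc0 hc k hk hck i hi
  rw [← op_skewElem, ← MulOpposite.op_mul, ← MulOpposite.op_smul] at this
  exact MulOpposite.op_injective this

end Skew

/-! ### Operators acting in chosen tensor factors -/

section Sites

variable {N m n : ℕ} {𝒜 : Type*}

/-- The matrix `X` acting in the factors `f 0`, `f 1`, … of `V^{⊗n}`. -/
def sites [Zero 𝒜] (f : Fin m → Fin n) (X : Matrix (Fin m → Fin N) (Fin m → Fin N) 𝒜) :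
    Matrix (Fin n → Fin N) (Fin n → Fin N) 𝒜 :=
  Matrix.of fun a b => if ∀ l, (∀ k, f k ≠ l) → a l = b l then X (a ∘ f) (b ∘ f) else 0

theorem sites_apply [Zero 𝒜] (f : Fin m → Fin n) (X : Matrix (Fin m → Fin N) (Fin m → Fin N) 𝒜)
    (a b : Fin n → Fin N) : sites f X a b =
      if ∀ l, (∀ k, f k ≠ l) → a l = b l then X (a ∘ f) (b ∘ f) else 0 := rfl

theorem extend_comp_self {f : Fin m → Fin n} (hf : Function.Injective f) (a : Fin n → Fin N) :
    Function.extend f (a ∘ f) a = a := by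
  ext l
  by_cases h : ∃ k, f k = l
  · obtain ⟨k, rfl⟩ := h
    simp [hf.extend_apply]
  · rw [Function.extend_apply' _ _ _ h]

theorem extend_comp_of_agree {f : Fin m → Fin n} (hf : Function.Injective f) {a b : Fin n → Fin N}
    (h : ∀ l, (∀ k, f k ≠ l) → a l = b l) : Function.extend f (a ∘ f) b = a := by
  ext l
  by_cases h' : ∃ k, f k = l
  · obtain ⟨k, rfl⟩ := h'
    simp [hf.extend_apply]
  · rw [Function.extend_apply' _ _ _ h', h l (by simpa using h')]

/-- Only intermediate indices that agree with `b` off the range of `f` contribute, and these are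
parametrized by their values on that range. -/
theorem mul_sites_apply [NonUnitalNonAssocSemiring 𝒜] {f : Fin m → Fin n}
    (hf : Function.Injective f) (Y : Matrix (Fin n → Fin N) (Fin n → Fin N) 𝒜)
    (X : Matrix (Fin m → Fin N) (Fin m → Fin N) 𝒜) (a b : Fin n → Fin N) :
    (Y * sites f X) a b = ∑ p, Y a (Function.extend f p b) * X p (b ∘ f) := by
  rw [Matrix.mul_apply]
  symm
  refine Fintype.sum_of_injective (fun p => Function.extend f p b)
    (Function.extend_injective hf b) _ _ ?_ ?_
  · intro c hc
    rw [sites_apply, if_neg, mul_zero]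
    exact fun h => hc ⟨c ∘ f, extend_comp_of_agree hf h⟩
  · intro p
    rw [sites_apply, if_pos, Function.extend_comp hf]
    intro l hl
    exact Function.extend_apply' _ _ _ (by simpa using hl)

theorem sites_mul_apply [NonUnitalNonAssocSemiring 𝒜] {f : Fin m → Fin n}
    (hf : Function.Injective f) (X : Matrix (Fin m → Fin N) (Fin m → Fin N) 𝒜)
    (Y : Matrix (Fin n → Fin N) (Fin n → Fin N) 𝒜) (a b : Fin n → Fin N) :
    (sites f X * Y) a b = ∑ p, X (a ∘ f) p * Y (Function.extend f p a) b := by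
  rw [Matrix.mul_apply]
  symm
  refine Fintype.sum_of_injective (fun p => Function.extend f p a)
    (Function.extend_injective hf a) _ _ ?_ ?_
  · intro c hc
    rw [sites_apply, if_neg, zero_mul]
    exact fun h => hc ⟨c ∘ f, extend_comp_of_agree hf fun l hl => (h l hl).symm⟩
  · intro p
    rw [sites_apply, if_pos, Function.extend_comp hf]
    intro l hl
    exact (Function.extend_apply' _ _ _ (by simpa using hl)).symm

theorem sites_apply_extend [Zero 𝒜] {f : Fin m → Fin n} (hf : Function.Injective f)
    (X : Matrix (Fin m → Fin N) (Fin m → Fin N) 𝒜) (a b : Fin n → Fin N) (p : Fin m → Fin N) :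
    sites f X a (Function.extend f p b) =
      if ∀ l, (∀ k, f k ≠ l) → a l = b l then X (a ∘ f) p else 0 := by
  rw [sites_apply, Function.extend_comp hf]
  refine if_congr (forall_congr' fun l => forall_congr' fun hl => ?_) rfl rfl
  rw [Function.extend_apply' _ _ _ (by simpa using hl)]

theorem sites_mul [NonUnitalNonAssocSemiring 𝒜] {f : Fin m → Fin n} (hf : Function.Injective f)
    (X Y : Matrix (Fin m → Fin N) (Fin m → Fin N) 𝒜) :
    sites f (X * Y) = sites f X * sites f Y := by
  ext a b
  simp only [mul_sites_apply hf, sites_apply_extend hf, ite_mul, zero_mul, sites_apply]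
  split_ifs with h
  · exact Matrix.mul_apply
  · simp

theorem sites_one [Zero 𝒜] [One 𝒜] {f : Fin m → Fin n} (hf : Function.Injective f) :
    sites f (1 : Matrix (Fin m → Fin N) (Fin m → Fin N) 𝒜) = 1 := by
  ext a b
  rw [sites_apply, Matrix.one_apply, Matrix.one_apply]
  by_cases h : a = b
  · simp [h]
  · rw [if_neg h]
    split_ifs with h1 h2
    · refine absurd ?_ h
      rw [← extend_comp_of_agree hf h1, h2, extend_comp_self hf]
    · rfl
    · rfl

theorem sites_add [AddZeroClass 𝒜] (f : Fin m → Fin n)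
    (X Y : Matrix (Fin m → Fin N) (Fin m → Fin N) 𝒜) :
    sites f (X + Y) = sites f X + sites f Y := by
  ext a b
  simp only [Matrix.add_apply, sites_apply]
  split_ifs <;> simp

theorem sites_sub [AddGroup 𝒜] (f : Fin m → Fin n)
    (X Y : Matrix (Fin m → Fin N) (Fin m → Fin N) 𝒜) :
    sites f (X - Y) = sites f X - sites f Y := by
  ext a b
  simp only [Matrix.sub_apply, sites_apply]
  split_ifs <;> simp

theorem sites_smul {K : Type*} [Zero 𝒜] [SMulZeroClass K 𝒜] (f : Fin m → Fin n) (c : K)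
    (X : Matrix (Fin m → Fin N) (Fin m → Fin N) 𝒜) : sites f (c • X) = c • sites f X := by
  ext a b
  simp only [Matrix.smul_apply, sites_apply]
  split_ifs <;> simp

theorem sites_mul_sites_apply [NonUnitalNonAssocSemiring 𝒜] {m' : ℕ} {f : Fin m → Fin n}
    {g : Fin m' → Fin n} (hg : Function.Injective g)
    (hfg : ∀ i j, f i ≠ g j) (X : Matrix (Fin m → Fin N) (Fin m → Fin N) 𝒜)
    (Y : Matrix (Fin m' → Fin N) (Fin m' → Fin N) 𝒜) (a b : Fin n → Fin N) :
    (sites f X * sites g Y) a b =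
      if ∀ l, (∀ k, f k ≠ l) → (∀ k, g k ≠ l) → a l = b l
        then X (a ∘ f) (b ∘ f) * Y (a ∘ g) (b ∘ g) else 0 := by
  rw [mul_sites_apply hg, Finset.sum_eq_single (a ∘ g)]
  · have e1 : Function.extend g (a ∘ g) b ∘ f = b ∘ f := by
      ext k
      simp only [Function.comp]
      rw [Function.extend_apply' _ _ _ (by rintro ⟨j, hj⟩; exact hfg k j hj.symm)]
    have e2 : (∀ l, (∀ k, f k ≠ l) → a l = Function.extend g (a ∘ g) b l) ↔
        ∀ l, (∀ k, f k ≠ l) → (∀ k, g k ≠ l) → a l = b l := by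
      refine forall_congr' fun l => forall_congr' fun _ => ?_
      by_cases h : ∃ k, g k = l
      · obtain ⟨k, rfl⟩ := h
        simp [hg.extend_apply]
      · rw [Function.extend_apply' _ _ _ h]
        simp only [not_exists] at h
        simp [h]
    rw [sites_apply, e1, if_congr e2 rfl rfl]
    split_ifs <;> simp
  · intro p _ hp
    rw [sites_apply, if_neg, zero_mul]
    refine fun h => hp ?_
    ext k
    have := h (g k) fun j => hfg j k
    rw [hg.extend_apply] at this
    simp [this]
  · simp

theorem commute_sites [NonUnitalNonAssocSemiring 𝒜] {m' : ℕ} {f : Fin m → Fin n}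
    {g : Fin m' → Fin n} (hf : Function.Injective f) (hg : Function.Injective g)
    (hfg : ∀ i j, f i ≠ g j) (X : Matrix (Fin m → Fin N) (Fin m → Fin N) 𝒜)
    (Y : Matrix (Fin m' → Fin N) (Fin m' → Fin N) 𝒜)
    (hXY : ∀ a b c d, Commute (X a b) (Y c d)) : Commute (sites f X) (sites g Y) := by
  ext a b
  rw [sites_mul_sites_apply hg hfg, sites_mul_sites_apply hf fun i j => (hfg j i).symm]
  exact if_congr (forall_congr' fun l => ⟨fun h h1 h2 => h h2 h1, fun h h1 h2 => h h2 h1⟩)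
    (hXY _ _ _ _).eq rfl

theorem oneSite_eq_sites [Zero 𝒜] (i : Fin n) (X : Matrix (Fin N) (Fin N) 𝒜) :
    oneSite i X = sites ![i] (X.submatrix (· 0) (· 0)) := by
  ext a b
  simp only [oneSite, sites_apply, Matrix.of_apply, Matrix.submatrix_apply, Fin.forall_fin_one,
    Function.comp, Matrix.cons_val_zero, ne_comm]

theorem twoSite_eq_sites [Zero 𝒜] (i j : Fin n) (X : Matrix (Fin N × Fin N) (Fin N × Fin N) 𝒜) :
    twoSite i j X = sites ![i, j] (X.submatrix (fun a => (a 0, a 1)) fun a => (a 0, a 1)) := by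
  ext a b
  simp only [twoSite, sites_apply, Matrix.of_apply, Matrix.submatrix_apply, Fin.forall_fin_two,
    Function.comp, Matrix.cons_val_zero, Matrix.cons_val_one, ne_comm, and_imp]

theorem sites_oneSite [Zero 𝒜] {f : Fin m → Fin n} (hf : Function.Injective f) (i : Fin m)
    (X : Matrix (Fin N) (Fin N) 𝒜) : sites f (oneSite i X) = oneSite (f i) X := by
  ext a b
  simp only [oneSite, sites_apply, Matrix.of_apply, Function.comp]
  rw [← ite_and]
  refine if_congr ⟨fun h l hl => ?_, fun h => ⟨fun l hl => h l (hl i).symm,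
    fun l hl => h _ (hf.ne hl)⟩⟩ rfl rfl
  by_cases h' : ∃ k, f k = l
  · obtain ⟨k, rfl⟩ := h'
    exact h.2 k fun e => hl (by rw [e])
  · exact h.1 l (by simpa using h')

theorem sites_twoSite [Zero 𝒜] {f : Fin m → Fin n} (hf : Function.Injective f) (i j : Fin m)
    (X : Matrix (Fin N × Fin N) (Fin N × Fin N) 𝒜) :
    sites f (twoSite i j X) = twoSite (f i) (f j) X := by
  ext a b
  simp only [twoSite, sites_apply, Matrix.of_apply, Function.comp]
  rw [← ite_and]
  refine if_congr ⟨fun h l hl hl' => ?_, fun h => ⟨fun l hl => h l (hl i).symm (hl j).symm,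
    fun l hl hl' => h _ (hf.ne hl) (hf.ne hl')⟩⟩ rfl rfl
  by_cases h' : ∃ k, f k = l
  · obtain ⟨k, rfl⟩ := h'
    exact h.2 k (fun e => hl (by rw [e])) fun e => hl' (by rw [e])
  · exact h.1 l (by simpa using h')

theorem injective_pair {i j : Fin n} (h : i ≠ j) : Function.Injective ![i, j] := by
  intro a b
  fin_cases a <;> fin_cases b <;> simp [h, h.symm]

theorem twoSite_mul [NonUnitalNonAssocSemiring 𝒜] {i j : Fin n} (h : i ≠ j)
    (X Y : Matrix (Fin N × Fin N) (Fin N × Fin N) 𝒜) :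
    twoSite i j (X * Y) = twoSite i j X * twoSite i j Y := by
  simp only [twoSite_eq_sites, ← sites_mul (injective_pair h)]
  congr 1
  exact (Matrix.submatrix_mul_equiv X Y _ (finTwoArrowEquiv (Fin N)) _).symm

theorem twoSite_one [Zero 𝒜] [One 𝒜] {i j : Fin n} (h : i ≠ j) :
    twoSite i j (1 : Matrix (Fin N × Fin N) (Fin N × Fin N) 𝒜) = 1 := by
  rw [twoSite_eq_sites, ← sites_one (injective_pair h)]
  congr 1
  exact Matrix.submatrix_one_equiv (finTwoArrowEquiv (Fin N))

theorem twoSite_add [AddZeroClass 𝒜] (i j : Fin n)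
    (X Y : Matrix (Fin N × Fin N) (Fin N × Fin N) 𝒜) :
    twoSite i j (X + Y) = twoSite i j X + twoSite i j Y := by
  simp only [twoSite_eq_sites, ← sites_add]
  rfl

theorem twoSite_smul {K : Type*} [Zero 𝒜] [SMulZeroClass K 𝒜] (i j : Fin n) (c : K)
    (X : Matrix (Fin N × Fin N) (Fin N × Fin N) 𝒜) :
    twoSite i j (c • X) = c • twoSite i j X := by
  simp only [twoSite_eq_sites, ← sites_smul]
  rfl

theorem oneSite_map {ℬ : Type*} [Zero 𝒜] [Zero ℬ] (i : Fin n) (X : Matrix (Fin N) (Fin N) 𝒜)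
    (φ : 𝒜 → ℬ) (hφ : φ 0 = 0) : (oneSite i X).map φ = oneSite i (X.map φ) := by
  ext a b
  simp only [oneSite, Matrix.map_apply, Matrix.of_apply]
  split_ifs <;> simp [hφ]

theorem twoSite_map {ℬ : Type*} [Zero 𝒜] [Zero ℬ] (i j : Fin n)
    (X : Matrix (Fin N × Fin N) (Fin N × Fin N) 𝒜)
    (φ : 𝒜 → ℬ) (hφ : φ 0 = 0) : (twoSite i j X).map φ = twoSite i j (X.map φ) := by
  ext a b
  simp only [twoSite, Matrix.map_apply, Matrix.of_apply]
  split_ifs <;> simp [hφ]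

theorem oneSite_mul [NonUnitalNonAssocSemiring 𝒜] (i : Fin n) (X Y : Matrix (Fin N) (Fin N) 𝒜) :
    oneSite i (X * Y) = oneSite i X * oneSite i Y := by
  have hi : Function.Injective ![i] := Function.injective_of_subsingleton _
  simp only [oneSite_eq_sites, ← sites_mul hi]
  congr 1
  exact (Matrix.submatrix_mul_equiv X Y _ (Equiv.funUnique (Fin 1) (Fin N)) _).symm

end Sites

/-! ### The Hecke algebra representation on the tensor power -/

section Gen

variable {N n : ℕ}

theorem IsHeckeSymmetry.mul_inv {q : ℂ} {R : Matrix (Fin N × Fin N) (Fin N × Fin N) ℂ}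
    (h : IsHeckeSymmetry q R) : R * R⁻¹ = 1 := by
  have h1 : R * (R - (q - q⁻¹) • 1) = 1 := by
    rw [mul_sub, h.hecke, mul_smul_comm, mul_one, add_sub_cancel_right]
  rwa [Matrix.inv_eq_right_inv h1]

theorem IsHeckeSymmetry.inv_mul {q : ℂ} {R : Matrix (Fin N × Fin N) (Fin N × Fin N) ℂ}
    (h : IsHeckeSymmetry q R) : R⁻¹ * R = 1 :=
  mul_eq_one_comm.mp h.mul_inv

/-- `R` in the factors `i`, `i + 1` of `V^{⊗n}`, and `1` if there are no such factors. -/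
noncomputable def generator (n : ℕ) (R : Matrix (Fin N × Fin N) (Fin N × Fin N) ℂ) (i : ℕ) :
    Matrix (Fin n → Fin N) (Fin n → Fin N) ℂ :=
  if h : i + 1 < n then twoSite ⟨i, by omega⟩ ⟨i + 1, h⟩ R else 1

theorem generator_of_lt {R : Matrix (Fin N × Fin N) (Fin N × Fin N) ℂ} {i : ℕ} (h : i + 1 < n) :
    generator n R i = twoSite ⟨i, by omega⟩ ⟨i + 1, h⟩ R := dif_pos h

theorem generator_mul_of_mul_eq_one {R S : Matrix (Fin N × Fin N) (Fin N × Fin N) ℂ}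
    (h : R * S = 1) (i : ℕ) : generator n R i * generator n S i = 1 := by
  unfold generator
  split_ifs with hi
  · rw [← twoSite_mul (by simp), h, twoSite_one (by simp)]
  · exact mul_one 1

theorem IsHeckeSymmetry.isHeckeRep {q : ℂ} {R : Matrix (Fin N × Fin N) (Fin N × Fin N) ℂ}
    (h : IsHeckeSymmetry q R) (n : ℕ) : IsHeckeRep n q (generator n R) where
  braid i hi := by
    -- The braid relation is transported from three factors to the factors `i`, `i + 1`, `i + 2`.
    let f : Fin 3 → Fin n := fun k => ⟨i + k, by omega⟩
    have hf : Function.Injective f := fun a b hab => by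
      simp only [f, Fin.mk.injEq] at hab
      omega
    have := congrArg (sites f) h.braid
    rw [generator_of_lt (by omega), generator_of_lt (by omega)]
    simp only [sites_mul hf, sites_twoSite hf] at this
    exact this
  comm i j hij hj := by
    rw [generator_of_lt (by omega), generator_of_lt (by omega), twoSite_eq_sites, twoSite_eq_sites]
    refine commute_sites (injective_pair (by simp)) (injective_pair (by simp)) ?_ _ _
      fun _ _ _ _ => Commute.all _ _
    intro a b
    fin_cases a <;> fin_cases b <;> simp <;> omega
  hecke i hi := by
    rw [generator_of_lt hi, ← twoSite_mul (by simp), h.hecke, twoSite_add, twoSite_one (by simp),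
      twoSite_smul]

theorem skewSymm_eq_skewElem (q : ℂ) (R : Matrix (Fin N × Fin N) (Fin N × Fin N) ℂ) (k : ℕ)
    (hk : k ≤ n) : skewSymm q R n k hk = skewElem q (qInt q) (generator n R) k := by
  induction k with
  | zero => rfl
  | succ k ih =>
    cases k with
    | zero => rfl
    | succ k => rw [skewSymm, skewElem, ih, generator_of_lt (by omega)]

theorem sites_generator {n' i : ℕ} (R : Matrix (Fin N × Fin N) (Fin N × Fin N) ℂ) (h : n ≤ n')
    (hi : i + 1 < n) : sites (Fin.castLE h) (generator n R i) = generator n' R i := by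
  rw [generator_of_lt hi, generator_of_lt (by omega), sites_twoSite (Fin.castLE_injective h)]
  rfl

theorem sites_skewElem {n' : ℕ} (q : ℂ) (c : ℕ → ℂ)
    (R : Matrix (Fin N × Fin N) (Fin N × Fin N) ℂ) (h : n ≤ n') (k : ℕ) (hk : k ≤ n) :
    sites (Fin.castLE h) (skewElem q c (generator n R) k) = skewElem q c (generator n' R) k := by
  have hf := Fin.castLE_injective h
  induction k with
  | zero => exact sites_one hf
  | succ k ih =>
    cases k with
    | zero => exact sites_one hf
    | succ k =>
      simp only [skewElem, sites_smul, sites_mul hf, sites_sub, sites_one hf, ih (by omega),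
        sites_generator R h (show k + 1 < n by omega)]

end Gen

/-! ### The quantum double as matrices over its algebra -/

section Double

variable {N n : ℕ} {𝒜 : Type*} [Ring 𝒜] [Algebra ℂ 𝒜]

theorem scalarMat_mul {ι : Type*} [Fintype ι] (X Y : Matrix ι ι ℂ) :
    scalarMat 𝒜 (X * Y) = scalarMat 𝒜 X * scalarMat 𝒜 Y :=
  Matrix.map_mul

theorem scalarMat_one {ι : Type*} [DecidableEq ι] : scalarMat 𝒜 (1 : Matrix ι ι ℂ) = 1 :=
  Matrix.map_one _ (map_zero _) (map_one _)

theorem scalarMat_smul {ι : Type*} (c : ℂ) (X : Matrix ι ι ℂ) :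
    scalarMat 𝒜 (c • X) = c • scalarMat 𝒜 X := by
  ext a b
  simp [scalarMat, Algebra.smul_def]

theorem twoSite_scalarMat (i j : Fin n) (X : Matrix (Fin N × Fin N) (Fin N × Fin N) ℂ) :
    twoSite i j (scalarMat 𝒜 X) = scalarMat 𝒜 (twoSite i j X) :=
  (twoSite_map i j X _ (map_zero _)).symm

variable (𝒜) in
/-- The operators `R_i` as units of the algebra of matrices over `𝒜`. -/
noncomputable def generatorUnit (n : ℕ) {q : ℂ} {R : Matrix (Fin N × Fin N) (Fin N × Fin N) ℂ}
    (h : IsHeckeSymmetry q R) (i : ℕ) : (Matrix (Fin n → Fin N) (Fin n → Fin N) 𝒜)ˣ where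
  val := scalarMat 𝒜 (generator n R i)
  inv := scalarMat 𝒜 (generator n R⁻¹ i)
  val_inv := by rw [← scalarMat_mul, generator_mul_of_mul_eq_one h.mul_inv, scalarMat_one]
  inv_val := by rw [← scalarMat_mul, generator_mul_of_mul_eq_one h.inv_mul, scalarMat_one]

variable {q : ℂ} {R : Matrix (Fin N × Fin N) (Fin N × Fin N) ℂ}

theorem val_generatorUnit (h : IsHeckeSymmetry q R) (i : ℕ) :
    (generatorUnit 𝒜 n h i : Matrix (Fin n → Fin N) (Fin n → Fin N) 𝒜) =
      scalarMat 𝒜 (generator n R i) := rfl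

theorem val_inv_generatorUnit (h : IsHeckeSymmetry q R) (i : ℕ) :
    (((generatorUnit 𝒜 n h i)⁻¹ : (Matrix (Fin n → Fin N) (Fin n → Fin N) 𝒜)ˣ) :
      Matrix (Fin n → Fin N) (Fin n → Fin N) 𝒜) = scalarMat 𝒜 (generator n R⁻¹ i) := rfl

theorem overlineCopy_eq_copy (h : IsHeckeSymmetry q R) (X : Matrix (Fin N) (Fin N) 𝒜) (k : ℕ)
    (hk : k < n) : overlineCopy R X n k hk =
      copy (generatorUnit 𝒜 n h) (oneSite ⟨0, by omega⟩ X) k := by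
  induction k with
  | zero => rfl
  | succ k ih =>
    rw [overlineCopy, copy, ih, twoSite_scalarMat, twoSite_scalarMat, ← generator_of_lt,
      ← generator_of_lt]
    rfl

theorem isBraidRep_generatorUnit (h : IsHeckeSymmetry q R) (n : ℕ) :
    IsBraidRep n (generatorUnit 𝒜 n h) where
  braid i hi := by
    ext1
    simp only [Units.val_mul, val_generatorUnit, ← scalarMat_mul, (h.isHeckeRep n).braid i hi]
  comm i j hij hj := by
    ext1
    simp only [Units.val_mul, val_generatorUnit, ← scalarMat_mul,
      ((h.isHeckeRep n).comm i j hij hj).eq]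

theorem commute_generatorUnit_oneSite (h : IsHeckeSymmetry q R) (X : Matrix (Fin N) (Fin N) 𝒜)
    (hn : 0 < n) (i : ℕ) (h0 : 0 < i) (hi : i + 1 < n) :
    Commute (generatorUnit 𝒜 n h i : Matrix (Fin n → Fin N) (Fin n → Fin N) 𝒜)
      (oneSite ⟨0, hn⟩ X) := by
  rw [val_generatorUnit, generator_of_lt hi, ← twoSite_scalarMat, twoSite_eq_sites, oneSite_eq_sites]
  refine commute_sites (injective_pair (by simp)) (Function.injective_of_subsingleton _) ?_ _ _
    fun _ _ _ _ => Algebra.commute_algebraMap_left _ _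
  intro a b
  fin_cases a <;> fin_cases b
  · exact fun e => h0.ne' (Fin.ext_iff.mp e)
  · exact fun e => Nat.succ_ne_zero i (Fin.ext_iff.mp e)

theorem map_free₁₂ (φ : FreeAlgebra ℂ (Gen N) →ₐ[ℂ] 𝒜)
    (X : Matrix (Fin N × Fin N) (Fin N × Fin N) ℂ) :
    (free₁₂ X).map φ = twoSite (n := 2) 0 1 (scalarMat 𝒜 X) := by
  rw [free₁₂, twoSite_map _ _ _ _ (map_zero φ)]
  congr 1
  ext a b
  simp [scalarMat]

theorem map_freeM₁ : (freeM₁ N).map (RingQuot.mkAlgHom ℂ (DoubleRel R)) =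
    oneSite (n := 2) 0 (matM R) :=
  oneSite_map _ _ _ (map_zero _)

theorem map_freeD₁ : (freeD₁ N).map (RingQuot.mkAlgHom ℂ (DoubleRel R)) =
    oneSite (n := 2) 0 (matD R) :=
  oneSite_map _ _ _ (map_zero _)

/-- The defining relations, assembled into matrix equations on two factors, are pushed along the
embedding of the first two factors into all `n`. -/
theorem isDouble_quantumDouble (h : IsHeckeSymmetry q R) (hn : 0 < n) :
    IsDouble n (generatorUnit (QuantumDouble R) n h) (oneSite ⟨0, hn⟩ (matM R))
      (oneSite ⟨0, hn⟩ (matD R)) where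
  rep := isBraidRep_generatorUnit h n
  comm_m := commute_generatorUnit_oneSite h _ hn
  comm_d := commute_generatorUnit_oneSite h _ hn
  refl_m h1 := by
    have hf := Fin.castLE_injective h1
    have := congrArg (sites (Fin.castLE h1))
      (Matrix.ext fun a b => RingQuot.mkAlgHom_rel ℂ (DoubleRel.reflM (R := R) a b) :
      (free₁₂ R * freeM₁ N * free₁₂ R * freeM₁ N).map (RingQuot.mkAlgHom ℂ (DoubleRel R)) =
        (freeM₁ N * free₁₂ R * freeM₁ N * free₁₂ R).map (RingQuot.mkAlgHom ℂ (DoubleRel R)))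
    simp only [Matrix.map_mul, map_free₁₂, map_freeM₁, sites_mul hf, sites_oneSite hf,
      sites_twoSite hf] at this
    simp only [val_generatorUnit, generator_of_lt (show 0 + 1 < n by omega), ← twoSite_scalarMat]
    exact this
  refl_d h1 := by
    have hf := Fin.castLE_injective h1
    have := congrArg (sites (Fin.castLE h1))
      (Matrix.ext fun a b => RingQuot.mkAlgHom_rel ℂ (DoubleRel.reflD (R := R) a b) :
      (free₁₂ R⁻¹ * freeD₁ N * free₁₂ R⁻¹ * freeD₁ N).map (RingQuot.mkAlgHom ℂ (DoubleRel R)) =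
        (freeD₁ N * free₁₂ R⁻¹ * freeD₁ N * free₁₂ R⁻¹).map (RingQuot.mkAlgHom ℂ (DoubleRel R)))
    simp only [Matrix.map_mul, map_free₁₂, map_freeD₁, sites_mul hf, sites_oneSite hf,
      sites_twoSite hf] at this
    simp only [val_inv_generatorUnit, generator_of_lt (show 0 + 1 < n by omega),
      ← twoSite_scalarMat]
    exact this
  perm h1 := by
    have hf := Fin.castLE_injective h1
    have := congrArg (sites (Fin.castLE h1))
      (Matrix.ext fun a b => RingQuot.mkAlgHom_rel ℂ (DoubleRel.perm (R := R) a b) :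
      (freeD₁ N * free₁₂ R * freeM₁ N * free₁₂ R).map (RingQuot.mkAlgHom ℂ (DoubleRel R)) =
        (free₁₂ R * freeM₁ N * free₁₂ R⁻¹ * freeD₁ N + free₁₂ R).map
          (RingQuot.mkAlgHom ℂ (DoubleRel R)))
    rw [Matrix.map_add _ (map_add _)] at this
    simp only [Matrix.map_mul, map_free₁₂, map_freeM₁, map_freeD₁, sites_mul hf, sites_add,
      sites_oneSite hf, sites_twoSite hf] at this
    simp only [val_generatorUnit, val_inv_generatorUnit, generator_of_lt (show 0 + 1 < n by omega),
      ← twoSite_scalarMat]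
    exact this

end Double

/-! ### Weighted partial traces -/

section RTrace

variable {N n : ℕ}

/-- `C ⊗ ⋯ ⊗ C` on `V^{⊗n}`. -/
def tensorPower (n : ℕ) (C : Matrix (Fin N) (Fin N) ℂ) :
    Matrix (Fin n → Fin N) (Fin n → Fin N) ℂ :=
  Matrix.of fun a b => ∏ i, C (a i) (b i)

theorem tensorPower_apply (C : Matrix (Fin N) (Fin N) ℂ) (a b : Fin n → Fin N) :
    tensorPower n C a b = ∏ i, C (a i) (b i) := rfl

/-- The partial trace over the last factor, weighted by `C`. -/
def partialTrace (C : Matrix (Fin N) (Fin N) ℂ)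
    (Y : Matrix (Fin (n + 1) → Fin N) (Fin (n + 1) → Fin N) ℂ) :
    Matrix (Fin n → Fin N) (Fin n → Fin N) ℂ :=
  Matrix.of fun a b => ∑ c, ∑ d, C c d * Y (Fin.snoc a d) (Fin.snoc b c)

theorem partialTrace_apply (C : Matrix (Fin N) (Fin N) ℂ)
    (Y : Matrix (Fin (n + 1) → Fin N) (Fin (n + 1) → Fin N) ℂ) (a b : Fin n → Fin N) :
    partialTrace C Y a b =
      ∑ c, ∑ d, C c d * Y (Fin.snoc a d : Fin (n + 1) → Fin N) (Fin.snoc b c) := rfl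

variable (C : Matrix (Fin N) (Fin N) ℂ)

theorem snoc_comp_castLE (a : Fin n → Fin N) (d : Fin N) :
    (Fin.snoc a d : Fin (n + 1) → Fin N) ∘ Fin.castLE n.le_succ = a := by
  ext i
  exact congrArg Fin.val (Fin.snoc_castSucc (α := fun _ => Fin N) d a i)

theorem extend_castLE_snoc (p a : Fin n → Fin N) (d : Fin N) :
    Function.extend (Fin.castLE n.le_succ) p (Fin.snoc a d : Fin (n + 1) → Fin N) =
      Fin.snoc p d := by
  ext i
  congr 1
  refine Fin.lastCases ?_ (fun i => ?_) i
  · rw [Function.extend_apply', Fin.snoc_last, Fin.snoc_last]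
    rintro ⟨k, hk⟩
    have := congrArg Fin.val hk
    simp only [Fin.val_castLE, Fin.val_last] at this
    omega
  · rw [Fin.snoc_castSucc]
    exact (Fin.castLE_injective n.le_succ).extend_apply p _ i

/-- With its right-hand counterpart, this makes the partial trace a bimodule map over operators on
the first `n` factors. -/
theorem partialTrace_sites_mul (X : Matrix (Fin n → Fin N) (Fin n → Fin N) ℂ)
    (Y : Matrix (Fin (n + 1) → Fin N) (Fin (n + 1) → Fin N) ℂ) :
    partialTrace C (sites (Fin.castLE n.le_succ) X * Y) = X * partialTrace C Y := by
  ext a b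
  simp only [partialTrace_apply, sites_mul_apply (Fin.castLE_injective n.le_succ),
    snoc_comp_castLE, extend_castLE_snoc, Matrix.mul_apply, Finset.mul_sum]
  rw [Finset.sum_comm' (t' := Finset.univ) (s' := fun _ => Finset.univ) (by simp)]
  simp_rw [Finset.sum_comm (s := (Finset.univ : Finset (Fin N)))
    (t := (Finset.univ : Finset (Fin n → Fin N)))]
  rw [Finset.sum_congr rfl fun p _ => Finset.sum_comm]
  refine Finset.sum_congr rfl fun p _ => Finset.sum_congr rfl fun c _ =>
    Finset.sum_congr rfl fun d _ => ?_
  ring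

theorem partialTrace_mul_sites (X : Matrix (Fin n → Fin N) (Fin n → Fin N) ℂ)
    (Y : Matrix (Fin (n + 1) → Fin N) (Fin (n + 1) → Fin N) ℂ) :
    partialTrace C (Y * sites (Fin.castLE n.le_succ) X) = partialTrace C Y * X := by
  ext a b
  simp only [partialTrace_apply, mul_sites_apply (Fin.castLE_injective n.le_succ),
    snoc_comp_castLE, extend_castLE_snoc, Matrix.mul_apply, Finset.mul_sum, Finset.sum_mul]
  simp_rw [Finset.sum_comm (s := (Finset.univ : Finset (Fin N)))
    (t := (Finset.univ : Finset (Fin n → Fin N)))]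
  refine Finset.sum_congr rfl fun p _ => Finset.sum_congr rfl fun c _ =>
    Finset.sum_congr rfl fun d _ => ?_
  ring

theorem partialTrace_sub (X Y : Matrix (Fin (n + 1) → Fin N) (Fin (n + 1) → Fin N) ℂ) :
    partialTrace C (X - Y) = partialTrace C X - partialTrace C Y := by
  ext a b
  simp only [partialTrace_apply, Matrix.sub_apply, mul_sub, Finset.sum_sub_distrib]

theorem partialTrace_smul (r : ℂ) (X : Matrix (Fin (n + 1) → Fin N) (Fin (n + 1) → Fin N) ℂ) :
    partialTrace C (r • X) = r • partialTrace C X := by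
  ext a b
  simp only [partialTrace_apply, Matrix.smul_apply, smul_eq_mul, Finset.mul_sum, mul_left_comm]

theorem partialTrace_one : partialTrace C (1 : Matrix (Fin (n + 1) → Fin N) _ ℂ) =
    C.trace • 1 := by
  ext a b
  simp only [partialTrace_apply, Matrix.one_apply, Matrix.smul_apply, Fin.snoc_inj, smul_eq_mul,
    Matrix.trace, Matrix.diag_apply]
  by_cases h : a = b <;> simp [h]

theorem partialTrace_generator {R : Matrix (Fin N × Fin N) (Fin N × Fin N) ℂ}
    (hC : ∀ i j, ∑ x, ∑ y, R (i, x) (j, y) * C y x = if i = j then 1 else 0) :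
    partialTrace C (generator (n + 2) R n) = 1 := by
  ext a b
  simp only [partialTrace_apply, generator_of_lt (show n + 1 < n + 2 by omega), Matrix.one_apply,
    twoSite, Matrix.of_apply]
  have e1 : ∀ (a : Fin (n + 1) → Fin N) (d : Fin N),
      (Fin.snoc a d : Fin (n + 2) → Fin N) ⟨n + 1, by omega⟩ = d :=
    fun a d => Fin.snoc_last (α := fun _ => Fin N) d a
  have e2 : ∀ (a : Fin (n + 1) → Fin N) (d : Fin N),
      (Fin.snoc a d : Fin (n + 2) → Fin N) ⟨n, by omega⟩ = a (Fin.last n) :=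
    fun a d => Fin.snoc_castSucc (α := fun _ => Fin N) d a (Fin.last n)
  have e3 : ∀ c d, (∀ l : Fin (n + 2), l ≠ ⟨n, by omega⟩ → l ≠ ⟨n + 1, by omega⟩ →
      (Fin.snoc a d : Fin (n + 2) → Fin N) l = (Fin.snoc b c : Fin (n + 2) → Fin N) l) ↔
      ∀ l, l ≠ Fin.last n → a l = b l := by
    intro c d
    rw [Fin.forall_fin_succ']
    simp only [Fin.snoc_castSucc]
    constructor
    · intro h l hl
      refine h.1 l (fun e => hl (Fin.castSucc_injective _ e)) fun e => ?_
      have := congrArg Fin.val e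
      simp only [Fin.val_castSucc] at this
      omega
    · exact fun h => ⟨fun l hl _ => h l fun e => hl (by rw [e]; rfl), fun _ h => absurd rfl h⟩
  simp only [e1, e2, e3, mul_ite, mul_zero]
  by_cases h : ∀ l, l ≠ Fin.last n → a l = b l
  · simp only [if_pos h]
    rw [Finset.sum_comm]
    simp only [mul_comm (C _ _)]
    rw [hC]
    refine if_congr ⟨fun h' => ?_, fun h' => by rw [h']⟩ rfl rfl
    ext l
    by_cases hl : l = Fin.last n
    · rw [hl, h']
    · rw [h l hl]
  · simp only [if_neg h, Finset.sum_const_zero]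
    rw [if_neg]
    rintro rfl
    exact h fun _ _ => rfl

theorem trace_tensorPower_succ_mul
    (Y : Matrix (Fin (n + 1) → Fin N) (Fin (n + 1) → Fin N) ℂ) :
    (tensorPower (n + 1) C * Y).trace = (tensorPower n C * partialTrace C Y).trace := by
  simp only [Matrix.trace, Matrix.diag_apply, Matrix.mul_apply, partialTrace_apply,
    tensorPower_apply, ← (Fin.snocEquiv fun _ => Fin N).sum_comp, Fintype.sum_prod_type,
    Fin.snocEquiv, Equiv.coe_fn_mk, Fin.prod_univ_castSucc, Fin.snoc_castSucc, Fin.snoc_last,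
    Finset.mul_sum]
  rw [Finset.sum_comm]
  refine Finset.sum_congr rfl fun a _ => ?_
  rw [Finset.sum_congr rfl fun p _ => Finset.sum_comm, Finset.sum_comm]
  refine Finset.sum_congr rfl fun b _ => Finset.sum_congr rfl fun c _ =>
    Finset.sum_congr rfl fun d _ => ?_
  ring

theorem tensorPower_extend {m : ℕ} {f : Fin m → Fin n} (hf : Function.Injective f)
    (a b : Fin n → Fin N) (p : Fin m → Fin N) :
    tensorPower n C a (Function.extend f p b) = tensorPower m C (a ∘ f) p *
      ∏ l ∈ (Finset.univ.image f)ᶜ, C (a l) (b l) := by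
  rw [tensorPower_apply, ← Finset.prod_mul_prod_compl (Finset.univ.image f),
    Finset.prod_image hf.injOn, tensorPower_apply]
  congr 1
  · exact Finset.prod_congr rfl fun k _ => by rw [hf.extend_apply]; rfl
  · refine Finset.prod_congr rfl fun l hl => ?_
    rw [Function.extend_apply' _ _ _ (by simpa using hl)]

theorem tensorPower_extend' {m : ℕ} {f : Fin m → Fin n} (hf : Function.Injective f)
    (a b : Fin n → Fin N) (p : Fin m → Fin N) :
    tensorPower n C (Function.extend f p a) b = tensorPower m C p (b ∘ f) *
      ∏ l ∈ (Finset.univ.image f)ᶜ, C (a l) (b l) := by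
  rw [tensorPower_apply, ← Finset.prod_mul_prod_compl (Finset.univ.image f),
    Finset.prod_image hf.injOn, tensorPower_apply]
  congr 1
  · exact Finset.prod_congr rfl fun k _ => by rw [hf.extend_apply]; rfl
  · refine Finset.prod_congr rfl fun l hl => ?_
    rw [Function.extend_apply' _ _ _ (by simpa using hl)]

theorem commute_tensorPower_sites {m : ℕ} {f : Fin m → Fin n} (hf : Function.Injective f)
    {X : Matrix (Fin m → Fin N) (Fin m → Fin N) ℂ} (h : Commute (tensorPower m C) X) :
    Commute (tensorPower n C) (sites f X) := by
  ext a b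
  rw [mul_sites_apply hf, sites_mul_apply hf]
  simp only [tensorPower_extend C hf, tensorPower_extend' C hf]
  have := congrFun (congrFun h.eq (a ∘ f)) (b ∘ f)
  simp only [Matrix.mul_apply] at this
  simp only [← mul_assoc, ← Finset.sum_mul, ← this]
  rw [Finset.sum_mul]
  exact Finset.sum_congr rfl fun p _ => by ring

theorem commute_tensorPower_generator {R : Matrix (Fin N × Fin N) (Fin N × Fin N) ℂ}
    (h : Commute (Matrix.of fun a b : Fin N × Fin N => C a.1 b.1 * C a.2 b.2) R) (i : ℕ) :
    Commute (tensorPower n C) (generator n R i) := by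
  unfold generator
  split_ifs with hi
  · rw [twoSite_eq_sites]
    refine commute_tensorPower_sites C (injective_pair (by simp)) ?_
    have e : tensorPower 2 C = (Matrix.of fun a b : Fin N × Fin N => C a.1 b.1 * C a.2 b.2).submatrix
        (finTwoArrowEquiv (Fin N)) (finTwoArrowEquiv (Fin N)) := by
      ext a b
      simp [tensorPower_apply]
    have := congrArg
      (Matrix.submatrix · (finTwoArrowEquiv (Fin N)) (finTwoArrowEquiv (Fin N))) h.eq
    simp only [← Matrix.submatrix_mul_equiv _ _ _ (finTwoArrowEquiv (Fin N))] at this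
    rw [e]
    exact this
  · exact Commute.one_right _

end RTrace

/-! ### The trace matrix C and its commutation with R -/

section SkewInverse

variable {N : ℕ} {q : ℂ} {R Ψ : Matrix (Fin N × Fin N) (Fin N × Fin N) ℂ}

theorem IsSkewInverse.sum_mul_traceMatrix (hΨ : IsSkewInverse R Ψ) (i j : Fin N) :
    ∑ x, ∑ y, R (i, x) (j, y) * traceMatrix Ψ y x = if i = j then 1 else 0 := by
  have : ∑ z, ∑ x, ∑ y, R (i, x) (j, y) * Ψ (y, z) (x, z) = ∑ z, flip N (i, z) (j, z) :=
    Finset.sum_congr rfl fun z _ => hΨ.1 i z j z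
  simp only [traceMatrix, Matrix.of_apply, Finset.mul_sum]
  rw [Finset.sum_congr rfl fun x _ => Finset.sum_comm, Finset.sum_comm, this]
  simp only [flip, Matrix.of_apply]
  by_cases h : i = j
  · subst h
    rw [Finset.sum_eq_single i] <;> simp +contextual [eq_comm]
  · rw [if_neg h]
    refine Finset.sum_eq_zero fun z _ => if_neg ?_
    rintro ⟨h1, h2⟩
    exact h (h1.trans h2)

/-- The second skew-inverse relation says that contraction with `Ψ` undoes contraction with `R`. -/
theorem IsSkewInverse.eq_sum (hΨ : IsSkewInverse R Ψ) {f g : Fin N → Fin N → ℂ}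
    (h : ∀ i j, ∑ a, ∑ b, R (i, a) (j, b) * f a b = g i j) (a b : Fin N) :
    f a b = ∑ j, ∑ i, Ψ (b, j) (a, i) * g i j := by
  simp only [← h, Finset.mul_sum]
  have : ∀ a' b', ∑ j, ∑ i, Ψ (b, j) (a, i) * (R (i, a') (j, b') * f a' b') =
      flip N (b, a') (a, b') * f a' b' := by
    intro a' b'
    rw [← hΨ.2 b a' a b']
    simp only [Finset.sum_mul, mul_assoc]
  calc f a b = ∑ a', ∑ b', flip N (b, a') (a, b') * f a' b' := by
        simp only [flip, Matrix.of_apply, ite_mul, one_mul, zero_mul, ite_and]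
        simp
    _ = ∑ a', ∑ b', ∑ j, ∑ i, Ψ (b, j) (a, i) * (R (i, a') (j, b') * f a' b') := by
        simp only [this]
    _ = ∑ p : Fin N × Fin N, ∑ r : Fin N × Fin N,
        Ψ (b, r.1) (a, r.2) * (R (r.2, p.1) (r.1, p.2) * f p.1 p.2) := by
        simp only [Fintype.sum_prod_type]
    _ = _ := by
        rw [Finset.sum_comm]
        simp only [Fintype.sum_prod_type]

theorem twoSite_mul_apply {n : ℕ} {i j : Fin n} (hij : i ≠ j)
    (X : Matrix (Fin N × Fin N) (Fin N × Fin N) ℂ)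
    (Y : Matrix (Fin n → Fin N) (Fin n → Fin N) ℂ) (a b : Fin n → Fin N) :
    (twoSite i j X * Y) a b =
      ∑ x, ∑ y, X (a i, a j) (x, y) * Y (Function.update (Function.update a i x) j y) b := by
  rw [twoSite_eq_sites, sites_mul_apply (injective_pair hij),
    ← (finTwoArrowEquiv (Fin N)).symm.sum_comp, Fintype.sum_prod_type]
  refine Finset.sum_congr rfl fun x _ => Finset.sum_congr rfl fun y _ => ?_
  have : Function.extend ![i, j] ((finTwoArrowEquiv (Fin N)).symm (x, y)) a =
      Function.update (Function.update a i x) j y := by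
    ext l
    congr 1
    by_cases hj : l = j
    · subst hj
      rw [Function.update_self]
      exact (injective_pair hij).extend_apply _ _ 1
    · rw [Function.update_of_ne hj]
      by_cases hi : l = i
      · subst hi
        rw [Function.update_self]
        exact (injective_pair hij).extend_apply _ _ 0
      · rw [Function.update_of_ne hi, Function.extend_apply']
        simp [Fin.exists_fin_two, Ne.symm hi, Ne.symm hj, eq_comm]
  rw [this]
  rfl

theorem twoSite_mul_twoSite_mul_twoSite_apply (X Y Z : Matrix (Fin N × Fin N) (Fin N × Fin N) ℂ)
    (i₁ i₂ i₃ j₁ j₂ j₃ : Fin N) :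
    (twoSite (n := 3) 1 2 X * (twoSite 0 1 Y * twoSite 1 2 Z) :
      Matrix (Fin 3 → Fin N) (Fin 3 → Fin N) ℂ) ![i₁, i₂, i₃] ![j₁, j₂, j₃] =
      ∑ x, ∑ e, ∑ y, X (i₂, i₃) (x, e) * (Y (i₁, x) (j₁, y) * Z (y, e) (j₂, j₃)) := by
  have u1 : ∀ x y, Function.update (Function.update ![i₁, i₂, i₃] 1 x) 2 y = ![i₁, x, y] := by
    intro x y; ext l; fin_cases l <;> rfl
  have u2 : ∀ x e z y, Function.update (Function.update ![i₁, x, e] 0 z) 1 y = ![z, y, e] := by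
    intro x e z y; ext l; fin_cases l <;> rfl
  rw [twoSite_mul_apply (by decide)]
  refine Finset.sum_congr rfl fun x _ => Finset.sum_congr rfl fun e _ => ?_
  rw [u1, twoSite_mul_apply (by decide), Finset.mul_sum, Finset.sum_eq_single j₁]
  · rw [Finset.mul_sum]
    refine Finset.sum_congr rfl fun y _ => ?_
    rw [u2]
    simp [twoSite, Fin.forall_fin_succ]
  · intro z _ hz
    rw [Finset.mul_sum]
    refine Finset.sum_eq_zero fun y _ => ?_
    rw [u2]
    simp [twoSite, Fin.forall_fin_succ, hz]
  · simp

/-- The hypothesis contracts the middle `R` with the left-hand side sought; `eq_sum` strips that `R`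
off and leaves a partial trace of `Ψ`, which is C. -/
theorem IsSkewInverse.sum_conj (hΨ : IsSkewInverse R Ψ)
    {X Z : Matrix (Fin N × Fin N) (Fin N × Fin N) ℂ}
    (h : partialTrace (traceMatrix Ψ)
      (twoSite (n := 3) 1 2 X * (twoSite 0 1 R * twoSite 1 2 Z)) = 1) (i j x y : Fin N) :
    ∑ c, ∑ d, ∑ e, traceMatrix Ψ c d * (X (i, d) (x, e) * Z (y, e) (j, c)) =
      if i = j then traceMatrix Ψ y x else 0 := by
  have s : ∀ a b c : Fin N, (Fin.snoc ![a, b] c : Fin 3 → Fin N) = ![a, b, c] := by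
    intro a b c; ext l; fin_cases l <;> rfl
  have key := hΨ.eq_sum
    (f := fun x y => ∑ c, ∑ d, ∑ e, traceMatrix Ψ c d * (X (i, d) (x, e) * Z (y, e) (j, c)))
    (g := fun i' j' => if i' = j' ∧ i = j then 1 else 0) ?_ x y
  · rw [key]
    by_cases hij : i = j
    · simp [hij, traceMatrix]
    · simp [hij]
  · intro i' j'
    have := congrFun (congrFun h ![i', i]) ![j', j]
    rw [partialTrace_apply, Matrix.one_apply] at this
    have e : (![i', i] = ![j', j]) ↔ (i' = j' ∧ i = j) := by simp
    rw [if_congr e rfl rfl, Finset.sum_congr rfl fun c _ => Finset.sum_congr rfl fun d _ =>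
      congrArg (traceMatrix Ψ c d * ·) (((by rw [s, s]) : _ = _).trans
        (twoSite_mul_twoSite_mul_twoSite_apply X R Z i' i d j' j c))] at this
    rw [← this]
    simp only [Finset.mul_sum]
    calc _ = ∑ p : Fin N × Fin N, ∑ r : Fin N × Fin N × Fin N,
        R (i', p.1) (j', p.2) * (traceMatrix Ψ r.1 r.2.1 *
          (X (i, r.2.1) (p.1, r.2.2) * Z (p.2, r.2.2) (j, r.1))) := by
          simp only [Fintype.sum_prod_type]
      _ = ∑ r : Fin N × Fin N, ∑ p : Fin N × Fin N × Fin N,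
        traceMatrix Ψ r.1 r.2 * (X (i, r.2) (p.1, p.2.1) * (R (i', p.1) (j', p.2.2) *
          Z (p.2.2, p.2.1) (j, r.1))) := by
          rw [← Fintype.sum_prod_type', ← Fintype.sum_prod_type']
          refine Fintype.sum_equiv
            { toFun := fun t => ((t.2.1, t.2.2.1), (t.1.1, t.2.2.2, t.1.2))
              invFun := fun t => ((t.2.1, t.2.2.2), (t.1.1, t.1.2, t.2.2.1))
              left_inv := fun _ => rfl
              right_inv := fun _ => rfl } _ _ fun t => ?_
          simp only [Equiv.coe_fn_mk]
          ring
      _ = _ := by simp only [Fintype.sum_prod_type]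

/-- The braid relation gives R_2⁻¹ R_1 R_2 = R_1 R_2 R_1⁻¹. Tracing out the third factor replaces
R_2 by 1, and the outer factors cancel. -/
theorem IsSkewInverse.partialTrace_conj (hR : IsHeckeSymmetry q R) (hΨ : IsSkewInverse R Ψ) :
    partialTrace (traceMatrix Ψ)
      (twoSite (n := 3) 1 2 R⁻¹ * (twoSite 0 1 R * twoSite 1 2 R)) = 1 ∧
    partialTrace (traceMatrix Ψ)
      (twoSite (n := 3) 1 2 R * (twoSite 0 1 R * twoSite 1 2 R⁻¹)) = 1 := by
  have hp := partialTrace_generator (n := 1) _ hΨ.sum_mul_traceMatrix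
  have g1 : ∀ X : Matrix (Fin N × Fin N) (Fin N × Fin N) ℂ,
    twoSite (n := 3) 1 2 X = generator 3 X 1 :=
      fun X => (generator_of_lt (show 1 + 1 < 3 by omega)).symm
  have g0 : ∀ X : Matrix (Fin N × Fin N) (Fin N × Fin N) ℂ,
    twoSite (n := 3) 0 1 X = generator 3 X 0 :=
      fun X => (generator_of_lt (show 0 + 1 < 3 by omega)).symm
  have s0 : ∀ X : Matrix (Fin N × Fin N) (Fin N × Fin N) ℂ,
    generator 3 X 0 = sites (Fin.castLE (Nat.le_succ 2)) (generator 2 X 0) :=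
    fun X => (sites_generator X _ (by omega)).symm
  have hb := (hR.isHeckeRep 3).braid 0 (by omega)
  simp only [zero_add] at hb
  have i1 := generator_mul_of_mul_eq_one (n := 3) hR.mul_inv 1
  have i1' := generator_mul_of_mul_eq_one (n := 3) hR.inv_mul 1
  have i0 := generator_mul_of_mul_eq_one (n := 3) hR.mul_inv 0
  have i0' := generator_mul_of_mul_eq_one (n := 3) hR.inv_mul 0
  have j0 := generator_mul_of_mul_eq_one (n := 2) hR.mul_inv 0
  have j0' := generator_mul_of_mul_eq_one (n := 2) hR.inv_mul 0
  rw [g0, g1, g1]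
  constructor
  · have : generator 3 R⁻¹ 1 * (generator 3 R 0 * generator 3 R 1) =
        generator 3 R 0 * (generator 3 R 1 * generator 3 R⁻¹ 0) := by
      calc _ = generator 3 R⁻¹ 1 * (generator 3 R 0 * generator 3 R 1) *
            (generator 3 R 0 * generator 3 R⁻¹ 0) := by rw [i0, mul_one]
        _ = generator 3 R⁻¹ 1 * (generator 3 R 0 * generator 3 R 1 * generator 3 R 0) *
            generator 3 R⁻¹ 0 := by simp only [mul_assoc]
        _ = (generator 3 R⁻¹ 1 * generator 3 R 1) * (generator 3 R 0 * (generator 3 R 1 *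
            generator 3 R⁻¹ 0)) := by rw [hb]; simp only [mul_assoc]
        _ = _ := by rw [i1', one_mul]
    rw [this, s0, s0, partialTrace_sites_mul, partialTrace_mul_sites, hp, one_mul, j0]
  · have : generator 3 R 1 * (generator 3 R 0 * generator 3 R⁻¹ 1) =
        generator 3 R⁻¹ 0 * (generator 3 R 1 * generator 3 R 0) := by
      calc _ = (generator 3 R⁻¹ 0 * generator 3 R 0) * (generator 3 R 1 *
            (generator 3 R 0 * generator 3 R⁻¹ 1)) := by rw [i0', one_mul]
        _ = generator 3 R⁻¹ 0 * (generator 3 R 0 * generator 3 R 1 * generator 3 R 0) *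
            generator 3 R⁻¹ 1 := by simp only [mul_assoc]
        _ = generator 3 R⁻¹ 0 * (generator 3 R 1 * generator 3 R 0) *
            (generator 3 R 1 * generator 3 R⁻¹ 1) := by rw [hb]; simp only [mul_assoc]
        _ = _ := by rw [i1, mul_one]
    rw [this, s0, s0, partialTrace_sites_mul, partialTrace_mul_sites, hp, one_mul, j0']

/-- `R` commutes with `C ⊗ C`. -/
theorem IsSkewInverse.commute_traceMatrix (hR : IsHeckeSymmetry q R) (hΨ : IsSkewInverse R Ψ) :
    Commute (Matrix.of fun a b : Fin N × Fin N =>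
      traceMatrix Ψ a.1 b.1 * traceMatrix Ψ a.2 b.2) R := by
  obtain ⟨h1, h2⟩ := hΨ.partialTrace_conj hR
  set C := traceMatrix Ψ with hC
  -- In operator form `k1` is C_2 R⁻¹ = Ψ_21 C_1 and `k2` is R⁻¹ C_2 = C_1 Ψ_21. Thus both C_1 C_2
  -- R⁻¹ and R⁻¹ C_1 C_2 equal C_1 Ψ_21 C_1.
  have k1 : ∀ i x e c, ∑ d, C c d * R⁻¹ (i, d) (x, e) = ∑ y, Ψ (c, i) (e, y) * C y x := by
    intro i x e c
    rw [hΨ.eq_sum (f := fun e c => ∑ d, C c d * R⁻¹ (i, d) (x, e))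
      (g := fun y j => if i = j then C y x else 0) ?_ e c]
    · simp
    · intro y j
      rw [← hΨ.sum_conj h1 i j x y, Finset.sum_comm]
      refine Finset.sum_congr rfl fun c _ => ?_
      simp only [Finset.mul_sum]
      rw [Finset.sum_comm]
      exact Finset.sum_congr rfl fun _ _ => Finset.sum_congr rfl fun _ _ => by ring
  have k2 : ∀ y j d e, ∑ c, R⁻¹ (y, e) (j, c) * C c d = ∑ x, C y x * Ψ (e, x) (d, j) := by
    intro y j d e
    rw [hΨ.eq_sum (f := fun d e => ∑ c, R⁻¹ (y, e) (j, c) * C c d)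
      (g := fun i x => if i = j then C y x else 0) ?_ d e]
    · simp [mul_comm]
    · intro i x
      rw [← hΨ.sum_conj h2 i j x y]
      symm
      rw [Finset.sum_comm]
      refine Finset.sum_congr rfl fun d _ => ?_
      simp only [Finset.mul_sum]
      rw [Finset.sum_comm]
      exact Finset.sum_congr rfl fun _ _ => Finset.sum_congr rfl fun _ _ => by ring
  have k3 : Commute (Matrix.of fun a b : Fin N × Fin N => C a.1 b.1 * C a.2 b.2) R⁻¹ := by
    ext ⟨i, j⟩ ⟨k, l⟩
    simp only [Matrix.mul_apply, Fintype.sum_prod_type, Matrix.of_apply]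
    have e1 : ∀ x, ∑ y, C i x * C j y * R⁻¹ (x, y) (k, l) =
        C i x * ∑ z, Ψ (j, x) (l, z) * C z k := fun x => by
      rw [← k1, Finset.mul_sum]
      exact Finset.sum_congr rfl fun _ _ => by ring
    have e2 : ∀ x, ∑ y, R⁻¹ (i, j) (x, y) * (C x k * C y l) =
        (∑ z, C i z * Ψ (j, z) (l, x)) * C x k := fun x => by
      rw [← k2, Finset.sum_mul]
      exact Finset.sum_congr rfl fun _ _ => by ring
    simp only [e1, e2, Finset.mul_sum, Finset.sum_mul]
    rw [Finset.sum_comm]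
    simp only [mul_assoc]
  have := congrArg (fun Z => R * Z * R) k3.eq
  simp only [mul_assoc, hR.inv_mul, mul_one] at this
  simp only [← mul_assoc, hR.mul_inv, one_mul] at this
  exact this.symm

end SkewInverse

/-! ### Regularized q-integers -/

section QNumber

/-- The `q`-integer as a Laurent polynomial in `q`, defined for `q = ±1` too. -/
noncomputable def qNum (q : ℂ) : ℕ → ℂ
  | 0 => 0
  | k + 1 => q ^ k + q⁻¹ * qNum q k

theorem qNum_one (q : ℂ) : qNum q 1 = 1 := by simp [qNum]

theorem sub_inv_ne_zero {q : ℂ} (h0 : q ≠ 0) (hq : q ^ 2 ≠ 1) : q - q⁻¹ ≠ 0 := by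
  intro h
  apply hq
  field_simp at h
  linear_combination h

theorem sub_inv_mul_qNum {q : ℂ} (h0 : q ≠ 0) (k : ℕ) :
    (q - q⁻¹) * qNum q k = q ^ k - (q ^ k)⁻¹ := by
  induction k with
  | zero => simp [qNum]
  | succ k ih =>
    rw [qNum, mul_add, mul_left_comm, ih, pow_succ]
    field_simp
    ring

/-- The deformation starts at the parameter 1, where the quotient in `qInt` degenerates; the
polynomial form is continuous there. -/
theorem qInt_eq_qNum {q : ℂ} (h0 : q ≠ 0) (hq : q ^ 2 ≠ 1) : qInt q = qNum q := by
  ext k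
  rw [qInt, ← sub_inv_mul_qNum h0, mul_div_cancel_left₀ _ (sub_inv_ne_zero h0 hq)]

/-- A zero forces q^{2k} = 1, hence q² = 1 by `h`; but then q k_q = k q^k, which is not zero. -/
theorem qNum_ne_zero {q : ℂ} (h0 : q ≠ 0) {k : ℕ} (hk : k ≠ 0)
    (h : q ^ (2 * k) = 1 → q ^ 2 = 1) : qNum q k ≠ 0 := by
  intro hz
  have h1 := sub_inv_mul_qNum h0 k
  have hqk : q ^ k ≠ 0 := pow_ne_zero _ h0
  have h2 : q ^ 2 = 1 := by
    apply h
    rw [hz, mul_zero] at h1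
    field_simp at h1
    rw [mul_comm, pow_mul]
    linear_combination -h1
  have h3 : ∀ j : ℕ, q * qNum q j = j * q ^ j := by
    intro j
    induction j with
    | zero => simp [qNum]
    | succ j ih =>
      have : q⁻¹ = q := by exact inv_eq_of_mul_eq_one_left (by rw [← sq, h2])
      rw [qNum, this, mul_add, ih]
      push_cast
      ring
  have := h3 k
  rw [hz, mul_zero, eq_comm, mul_eq_zero, Nat.cast_eq_zero] at this
  exact this.elim hk hqk

theorem qNum_sub {q : ℂ} (h0 : q ≠ 0) (hq : q ^ 2 ≠ 1) {k n : ℕ} (hk : k ≤ n) :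
    q ^ k * ((q ^ n)⁻¹ * qNum q n) - qNum q k = (q ^ n)⁻¹ * qNum q (n - k) := by
  obtain ⟨m, rfl⟩ := Nat.exists_eq_add_of_le hk
  rw [← mul_right_inj' (sub_inv_ne_zero h0 hq), Nat.add_sub_cancel_left]
  have e1 := sub_inv_mul_qNum h0 k
  have e2 := sub_inv_mul_qNum h0 m
  have e3 := sub_inv_mul_qNum h0 (k + m)
  generalize q - q⁻¹ = r at *
  rw [mul_sub, e1, mul_left_comm r (q ^ k), mul_left_comm r _ (qNum q (k + m)), e3,
    mul_left_comm r, e2, pow_add]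
  field_simp
  ring

theorem pow_mul_qNum_succ {q : ℂ} (h0 : q ≠ 0) (hq : q ^ 2 ≠ 1) (k : ℕ) :
    q ^ (k + 1) * qNum q (k + 1) = q ^ k * qNum q k + q ^ (2 * k + 1) := by
  rw [← mul_right_inj' (sub_inv_ne_zero h0 hq)]
  have e1 := sub_inv_mul_qNum h0 k
  have e2 := sub_inv_mul_qNum h0 (k + 1)
  rw [mul_left_comm, e2, mul_add, mul_left_comm, e1, two_mul]
  field_simp
  ring

end QNumber

/-! ### Rank and trace of idempotents -/

section Idempotent

variable {ι : Type*} [Fintype ι] [DecidableEq ι]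

theorem trace_eq_rank_of_mul_self {A : Matrix ι ι ℂ} (h : A * A = A) :
    A.trace = (A.rank : ℂ) := by
  have hp : IsIdempotentElem (Matrix.toLin' A) := by
    rw [IsIdempotentElem, Module.End.mul_eq_comp, ← Matrix.toLin'_mul, h]
  have := (LinearMap.IsIdempotentElem.isProj_range _ hp).trace
  rw [Matrix.trace_toLin'_eq] at this
  rw [this]
  rfl

theorem eq_zero_of_mul_self_of_trace_eq_zero {A : Matrix ι ι ℂ} (h : A * A = A)
    (h0 : A.trace = 0) : A = 0 := by
  have hp : IsIdempotentElem (Matrix.toLin' A) := by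
    rw [IsIdempotentElem, Module.End.mul_eq_comp, ← Matrix.toLin'_mul, h]
  rw [← Matrix.trace_toLin'_eq, LinearMap.IsIdempotentElem.trace_eq_zero_iff hp] at h0
  exact (LinearEquiv.map_eq_zero_iff _).mp h0

theorem exists_eq_vecMulVec_of_rank_eq_one {A : Matrix ι ι ℂ} (h : A.rank = 1) :
    ∃ u v : ι → ℂ, A = Matrix.vecMulVec u v := by
  obtain ⟨u, -, hu⟩ := finrank_eq_one_iff'.mp h
  choose v hv using hu
  have hcol : ∀ j, A.col j ∈ LinearMap.range A.mulVecLin := fun j =>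
    ⟨Pi.single j 1, by rw [Matrix.mulVecLin_apply, Matrix.mulVec_single_one]⟩
  refine ⟨u, fun j => v ⟨A.col j, hcol j⟩, ?_⟩
  ext i j
  have := congrFun (congrArg Subtype.val (hv ⟨A.col j, hcol j⟩)) i
  rw [Matrix.vecMulVec_apply, mul_comm]
  exact this.symm

/-- The rank is constant along a continuous path of idempotents. -/
theorem trace_eq_of_continuousOn_idempotent {s : Set ℝ} (hs : IsPreconnected s)
    {A : ℝ → Matrix ι ι ℂ} (hA : ContinuousOn A s) (h : ∀ t ∈ s, A t * A t = A t) {x y : ℝ}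
    (hx : x ∈ s) (hy : y ∈ s) : (A x).trace = (A y).trace := by
  have hc : ContinuousOn (fun t => (A t).trace.re) s :=
    (Complex.continuous_re.comp continuous_id.matrix_trace).comp_continuousOn hA
  -- A continuous function on a preconnected set with values in the discrete set of natural numbers
  -- is constant.
  have := hs.constant_of_mapsTo
    (Nat.isClosedEmbedding_coe_real.isInducing.isDiscrete_range) hc
    (fun t ht => ⟨(A t).rank, by
      simp only [trace_eq_rank_of_mul_self (h t ht), Complex.natCast_re]⟩) hx hy
  simp only [trace_eq_rank_of_mul_self (h x hx), trace_eq_rank_of_mul_self (h y hy),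
    Complex.natCast_re] at this ⊢
  exact_mod_cast this

end Idempotent

/-! ### The classical antisymmetrizer at the flip -/

section Flip

variable {N n : ℕ}

theorem extend_pair_swap {i j : Fin n} (hij : i ≠ j) (b : Fin n → Fin N) :
    Function.extend ![i, j] ![b j, b i] b = b ∘ Equiv.swap i j := by
  ext l
  congr 1
  by_cases hi : l = i
  · subst hi
    rw [Function.comp, Equiv.swap_apply_left]
    exact (injective_pair hij).extend_apply _ _ 0
  by_cases hj : l = j
  · subst hj
    rw [Function.comp, Equiv.swap_apply_right]
    exact (injective_pair hij).extend_apply _ _ 1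
  rw [Function.comp, Equiv.swap_apply_of_ne_of_ne hi hj, Function.extend_apply']
  simp [Fin.exists_fin_two, Ne.symm hi, Ne.symm hj]

theorem mul_twoSite_flip_apply {i j : Fin n} (hij : i ≠ j)
    (Y : Matrix (Fin n → Fin N) (Fin n → Fin N) ℂ) (a b : Fin n → Fin N) :
    (Y * twoSite i j (flip N)) a b = Y a (b ∘ Equiv.swap i j) := by
  rw [twoSite_eq_sites, mul_sites_apply (injective_pair hij), Finset.sum_eq_single ![b j, b i],
    extend_pair_swap hij]
  · simp [flip]
  · intro p _ hp
    refine mul_eq_zero_of_right _ (if_neg ?_)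
    rintro ⟨h1, h2⟩
    refine hp ?_
    ext k
    fin_cases k
    · exact congrArg Fin.val h1
    · exact congrArg Fin.val h2
  · simp

theorem twoSite_flip_mul_apply {i j : Fin n} (hij : i ≠ j)
    (Y : Matrix (Fin n → Fin N) (Fin n → Fin N) ℂ) (a b : Fin n → Fin N) :
    (twoSite i j (flip N) * Y) a b = Y (a ∘ Equiv.swap i j) b := by
  rw [twoSite_eq_sites, sites_mul_apply (injective_pair hij), Finset.sum_eq_single ![a j, a i],
    extend_pair_swap hij]
  · simp [flip]
  · intro p _ hp
    refine mul_eq_zero_of_left (if_neg ?_) _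
    rintro ⟨h1, h2⟩
    refine hp ?_
    ext k
    fin_cases k
    · exact congrArg Fin.val h2.symm
    · exact congrArg Fin.val h1.symm
  · simp

theorem comp_perm_eq_sign_mul {g : (Fin n → Fin N) → ℂ}
    (hg : ∀ (i : ℕ) (hi : i + 1 < n) (b : Fin n → Fin N),
      g (b ∘ Equiv.swap ⟨i, by omega⟩ ⟨i + 1, hi⟩) = -g b) (σ : Equiv.Perm (Fin n))
    (b : Fin n → Fin N) : g (b ∘ σ) = (Equiv.Perm.sign σ : ℤ) * g b := by
  cases n with
  | zero => simp [Subsingleton.elim σ 1]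
  | succ n =>
    have hσ : σ ∈ Submonoid.closure
        (Set.range fun i : Fin n => Equiv.swap i.castSucc i.succ) := by
      rw [Equiv.Perm.mclosure_swap_castSucc_succ]
      trivial
    induction hσ using Submonoid.closure_induction generalizing b with
    | mem x hx =>
      obtain ⟨i, rfl⟩ := hx
      have := hg i (by omega) b
      simp only [Equiv.Perm.sign_swap i.castSucc_lt_succ.ne]
      simp only [Units.val_neg, Units.val_one, Int.cast_neg, Int.cast_one, neg_mul, one_mul]
      exact this
    | one => simp
    | mul x y _ _ hx hy =>
      rw [Equiv.Perm.coe_mul, ← Function.comp_assoc, hy, hx, Equiv.Perm.sign_mul]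
      push_cast
      ring

theorem eq_zero_of_not_injective {g : (Fin n → Fin N) → ℂ}
    (hg : ∀ (σ : Equiv.Perm (Fin n)) (b : Fin n → Fin N),
      g (b ∘ σ) = (Equiv.Perm.sign σ : ℤ) * g b) {b : Fin n → Fin N}
    (hb : ¬ Function.Injective b) : g b = 0 := by
  simp only [Function.Injective, not_forall] at hb
  obtain ⟨i, j, hij, hne⟩ := hb
  have h1 : b ∘ Equiv.swap i j = b := by
    ext l
    simp only [Function.comp]
    rcases eq_or_ne l i with rfl | hi
    · rw [Equiv.swap_apply_left, hij]
    rcases eq_or_ne l j with rfl | hj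
    · rw [Equiv.swap_apply_right, hij]
    rw [Equiv.swap_apply_of_ne_of_ne hi hj]
  have h2 := hg (Equiv.swap i j) b
  rw [h1, Equiv.Perm.sign_swap hne] at h2
  push_cast at h2
  linear_combination h2 / 2

/-- The components of `e₁ ∧ ⋯ ∧ e_N`. -/
noncomputable def wedgeVec (N : ℕ) (a : Fin N → Fin N) : ℂ :=
  (Matrix.of fun i j => if a i = j then (1 : ℂ) else 0).det

theorem wedgeVec_comp (σ : Equiv.Perm (Fin N)) (a : Fin N → Fin N) :
    wedgeVec N (a ∘ σ) = (Equiv.Perm.sign σ : ℤ) * wedgeVec N a := by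
  rw [wedgeVec, wedgeVec, ← Matrix.det_permute σ]
  rfl

theorem wedgeVec_id : wedgeVec N id = 1 := by
  exact Matrix.det_one

theorem skewElem_flip_mul_generator (n : ℕ) (i : ℕ) (hi : i + 1 < n)
    (hflip : IsHeckeSymmetry 1 (flip N)) (a b : Fin n → Fin N) :
    skewElem 1 (qNum 1) (generator n (flip N)) n a
        (b ∘ Equiv.swap ⟨i, by omega⟩ ⟨i + 1, hi⟩) =
      -skewElem 1 (qNum 1) (generator n (flip N)) n a b := by
  have h := (hflip.isHeckeRep n).skewElem_mul one_ne_zero (qNum_one 1) (fun _ => rfl) n le_rfl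
    (fun j h2 _ => qNum_ne_zero one_ne_zero (by omega) (by simp)) i hi
  rw [generator_of_lt hi] at h
  have := congrFun (congrFun h a) b
  rw [mul_twoSite_flip_apply (by simp)] at this
  simpa using this

/-- Each row is an alternating function of `N + 1` indices with only `N` possible values, so an
index always repeats. -/
theorem skewElem_flip_eq_zero (hflip : IsHeckeSymmetry 1 (flip N)) :
    skewElem 1 (qNum 1) (generator (N + 1) (flip N)) (N + 1) = 0 := by
  ext a b
  refine eq_zero_of_not_injective (fun σ b => comp_perm_eq_sign_mul (fun i hi b =>
    skewElem_flip_mul_generator (N + 1) i hi hflip a b) σ b) fun h => ?_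
  simpa using Fintype.card_le_of_injective b h

/-- Rows are alternating, hence multiples of `wedgeVec`, and `wedgeVec` itself is fixed. So the
matrix is w wᵀ / (wᵀ w), of trace 1. -/
theorem trace_skewElem_flip (hflip : IsHeckeSymmetry 1 (flip N)) :
    (skewElem 1 (qNum 1) (generator N (flip N)) N).trace = 1 := by
  have hA := fun i hi => skewElem_flip_mul_generator (N := N) N i hi hflip
  have hB : skewElem 1 (qNum 1) (generator N (flip N)) N * Matrix.of (fun a _ => wedgeVec N a) =
      Matrix.of (fun a _ : Fin N → Fin N => wedgeVec N a) := by
    refine skewElem_mul_of_eigen (fun _ => rfl) N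
      (fun j h2 _ => qNum_ne_zero one_ne_zero (by omega) (by simp)) fun i hi => ?_
    ext a b
    rw [generator_of_lt hi, twoSite_flip_mul_apply (by simp), Matrix.of_apply, wedgeVec_comp,
      Equiv.Perm.sign_swap (by simp)]
    simp
  generalize skewElem 1 (qNum 1) (generator N (flip N)) N = A at hA hB
  have hAw : ∀ a b, A a b = A a id * wedgeVec N b := by
    intro a b
    have hs := comp_perm_eq_sign_mul (g := A a) fun i hi b => hA i hi a b
    by_cases hb : Function.Injective b
    · obtain ⟨σ, rfl⟩ : ∃ σ : Equiv.Perm (Fin N), id ∘ σ = b :=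
        ⟨Equiv.ofBijective b (Finite.injective_iff_bijective.mp hb), rfl⟩
      rw [hs σ, wedgeVec_comp, wedgeVec_id]
      ring
    · rw [eq_zero_of_not_injective hs hb, eq_zero_of_not_injective wedgeVec_comp hb, mul_zero]
  have hw : ∀ a, A a id * ∑ b, wedgeVec N b * wedgeVec N b = wedgeVec N a := by
    intro a
    have := congrFun (congrFun hB a) a
    simp only [Matrix.mul_apply, Matrix.of_apply] at this
    rw [← this, Finset.mul_sum]
    exact Finset.sum_congr rfl fun b _ => by rw [hAw a b]; ring
  have hS : ∑ b, wedgeVec N b * wedgeVec N b ≠ 0 := by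
    intro h
    have := hw id
    rw [h, mul_zero, wedgeVec_id] at this
    exact zero_ne_one this
  rw [← mul_left_inj' hS, one_mul, Matrix.trace, Finset.sum_mul]
  refine Finset.sum_congr rfl fun a _ => ?_
  rw [Matrix.diag_apply, hAw, mul_right_comm, hw]

end Flip

/-! ### Continuity along the deformation -/

section Deformation

variable {N : ℕ}

theorem continuousOn_generator {s : Set ℝ} {S : ℝ → Matrix (Fin N × Fin N) (Fin N × Fin N) ℂ}
    (hS : ContinuousOn S s) (n i : ℕ) : ContinuousOn (fun t => generator n (S t) i) s := by
  unfold generator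
  split_ifs with h
  · refine continuousOn_pi.mpr fun a => continuousOn_pi.mpr fun b => ?_
    simp only [twoSite, Matrix.of_apply]
    split_ifs
    · exact continuousOn_pi.mp (continuousOn_pi.mp hS _) _
    · exact continuousOn_const
  · exact continuousOn_const

theorem continuousOn_qNum {s : Set ℝ} {p : ℝ → ℂ} (hp : ContinuousOn p s)
    (h0 : ∀ t ∈ s, p t ≠ 0) (k : ℕ) : ContinuousOn (fun t => qNum (p t) k) s := by
  induction k with
  | zero => exact continuousOn_const
  | succ k ih => exact (hp.pow k).add ((hp.inv₀ h0).mul ih)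

theorem continuousOn_skewElem {s : Set ℝ} {p : ℝ → ℂ}
    {S : ℝ → Matrix (Fin N × Fin N) (Fin N × Fin N) ℂ} (hp : ContinuousOn p s)
    (h0 : ∀ t ∈ s, p t ≠ 0) (hS : ContinuousOn S s) (n k : ℕ)
    (hk : ∀ t ∈ s, ∀ j, 2 ≤ j → j ≤ k → qNum (p t) j ≠ 0) :
    ContinuousOn (fun t => skewElem (p t) (qNum (p t)) (generator n (S t)) k) s := by
  induction k with
  | zero => exact continuousOn_const
  | succ k ih =>
    cases k with
    | zero => exact continuousOn_const
    | succ k =>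
      have ih := ih fun t ht j h2 hj => hk t ht j h2 (by omega)
      exact ((continuousOn_qNum hp h0 (k + 2)).inv₀ fun t ht => hk t ht _ (by omega) le_rfl).smul
        ((ih.mul (((hp.pow _).smul continuousOn_const).sub
          ((continuousOn_qNum hp h0 _).smul (continuousOn_generator hS n k)))).mul ih)

variable {q : ℂ} {R : Matrix (Fin N × Fin N) (Fin N × Fin N) ℂ}

theorem IsDeformationOfFlip.trace_skewElem (h : IsDeformationOfFlip q R)
    (hqk : ∀ k : ℕ, 2 ≤ k → k ≤ N → q ^ (2 * k) ≠ 1) :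
    (skewElem q (qNum q) (generator N R) N).trace = 1 := by
  obtain ⟨p, S, hp, hS, hH, hgen, hp0, hS0, hp1, hS1⟩ := h
  have m0 : (0 : ℝ) ∈ Set.Icc (0 : ℝ) 1 := by simp
  have m1 : (1 : ℝ) ∈ Set.Icc (0 : ℝ) 1 := by simp
  have h0 : ∀ t ∈ Set.Icc (0 : ℝ) 1, p t ≠ 0 := fun t ht => (hH t ht).ne_zero
  have hk : ∀ t ∈ Set.Icc (0 : ℝ) 1, ∀ j, 2 ≤ j → j ≤ N → qNum (p t) j ≠ 0 := by
    intro t ht j h2 hj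
    refine qNum_ne_zero (h0 t ht) (by omega) fun e => ?_
    rcases ht.2.lt_or_eq with h1 | rfl
    · exact hgen t ⟨ht.1, h1⟩ j h2 (by omega) e
    · exact absurd (hp1 ▸ e) (hqk j h2 hj)
  have := trace_eq_of_continuousOn_idempotent (isPreconnected_Icc)
    (continuousOn_skewElem hp h0 hS N N hk) (fun t ht =>
      ((hH t ht).isHeckeRep N).skewElem_mul_self (h0 t ht) (qNum_one _) (fun _ => rfl) N le_rfl
        (hk t ht)) m1 m0
  simp only [hp0, hS0, hp1, hS1] at this
  rw [this]
  have := hH 0 m0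
  rw [hp0, hS0] at this
  exact trace_skewElem_flip this

/-- This is the numerator of A^{(N+1)}. The form without the denominator is needed because (N+1)_q
may vanish at the end of the path. -/
theorem IsDeformationOfFlip.skewElem_mul_mul_skewElem (h : IsDeformationOfFlip q R) (hN : 0 < N)
    (hqk : ∀ k : ℕ, 2 ≤ k → k ≤ N → q ^ (2 * k) ≠ 1) :
    skewElem q (qNum q) (generator (N + 1) R) N *
      (q ^ N • 1 - qNum q N • generator (N + 1) R (N - 1)) *
        skewElem q (qNum q) (generator (N + 1) R) N = 0 := by
  obtain ⟨p, S, hp, hS, hH, hgen, hp0, hS0, hp1, hS1⟩ := h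
  have m0 : (0 : ℝ) ∈ Set.Ico (0 : ℝ) 1 := by simp
  have m1 : (1 : ℝ) ∈ Set.Icc (0 : ℝ) 1 := by simp
  have h0 : ∀ t ∈ Set.Icc (0 : ℝ) 1, p t ≠ 0 := fun t ht => (hH t ht).ne_zero
  have hk : ∀ t ∈ Set.Icc (0 : ℝ) 1, ∀ j, 2 ≤ j → j ≤ N → qNum (p t) j ≠ 0 := by
    intro t ht j h2 hj
    refine qNum_ne_zero (h0 t ht) (by omega) fun e => ?_
    rcases ht.2.lt_or_eq with h1 | rfl
    · exact hgen t ⟨ht.1, h1⟩ j h2 (by omega) e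
    · exact absurd (hp1 ▸ e) (hqk j h2 hj)
  have hk' : ∀ t ∈ Set.Ico (0 : ℝ) 1, ∀ j, 2 ≤ j → j ≤ N + 1 → qNum (p t) j ≠ 0 :=
    fun t ht j h2 hj => qNum_ne_zero (h0 t (Set.Ico_subset_Icc_self ht)) (by omega)
      (hgen t ht j h2 hj)
  have hsub : Set.Ico (0 : ℝ) 1 ⊆ Set.Icc 0 1 := Set.Ico_subset_Icc_self
  have hid : ∀ t ∈ Set.Ico (0 : ℝ) 1, _ := fun t ht =>
    ((hH t (hsub ht)).isHeckeRep (N + 1)).skewElem_mul_self (h0 t (hsub ht)) (qNum_one _)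
      (fun _ => rfl) (N + 1) le_rfl (hk' t ht)
  have hz : ∀ t ∈ Set.Ico (0 : ℝ) 1,
      skewElem (p t) (qNum (p t)) (generator (N + 1) (S t)) (N + 1) = 0 := by
    intro t ht
    have := trace_eq_of_continuousOn_idempotent (isPreconnected_Ico)
      (continuousOn_skewElem (hp.mono hsub) (fun t ht => h0 t (hsub ht)) (hS.mono hsub)
        (N + 1) (N + 1) hk') hid ht m0
    have hf := hH 0 (hsub m0)
    rw [hp0, hS0] at hf
    simp only [hp0, hS0, skewElem_flip_eq_zero hf, Matrix.trace_zero] at this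
    exact eq_zero_of_mul_self_of_trace_eq_zero (hid t ht) this
  have hA := continuousOn_skewElem hp h0 hS (N + 1) N hk
  have hX : ContinuousOn (fun t => skewElem (p t) (qNum (p t)) (generator (N + 1) (S t)) N *
      ((p t) ^ N • 1 - qNum (p t) N • generator (N + 1) (S t) (N - 1)) *
        skewElem (p t) (qNum (p t)) (generator (N + 1) (S t)) N) (Set.Icc 0 1) :=
    (hA.mul (((hp.pow N).smul (continuousOn_const (c := 1))).sub
    ((continuousOn_qNum hp h0 N).smul (continuousOn_generator hS (N + 1) (N - 1))))).mul hA
  -- The numerator is continuous up to the endpoint and vanishes before it.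
  have hE := Set.EqOn.of_subset_closure (s := Set.Ico (0 : ℝ) 1) (t := Set.Icc 0 1)
    (g := fun _ => 0)
    (fun t ht => ?_) hX continuousOn_const hsub (by rw [closure_Ico (by norm_num)]) m1
  · simpa only [hp1, hS1] using hE
  · have := hz t ht
    obtain ⟨M, rfl⟩ := Nat.exists_eq_succ_of_ne_zero hN.ne'
    rw [skewElem] at this
    exact (smul_eq_zero.mp this).resolve_left (inv_ne_zero (hk' t ht _ (by omega) le_rfl))

end Deformation

/-! ### The R-trace of the antisymmetrizer -/

section TraceSkew

variable {N : ℕ} {q : ℂ} {R Ψ : Matrix (Fin N × Fin N) (Fin N × Fin N) ℂ}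

/-- The outer antisymmetrizers do not touch the last factor, so only the middle one is traced: 1
becomes Tr C and R_k becomes 1. -/
theorem IsSkewInverse.partialTrace_skew (hR : IsHeckeSymmetry q R) (hΨ : IsSkewInverse R Ψ)
    {k : ℕ} (hk : 0 < k) (hck : ∀ j, 2 ≤ j → j ≤ k → qNum q j ≠ 0) :
    partialTrace (traceMatrix Ψ) (skewElem q (qNum q) (generator (k + 1) R) k *
      (q ^ k • 1 - qNum q k • generator (k + 1) R (k - 1)) *
        skewElem q (qNum q) (generator (k + 1) R) k) =
      (q ^ k * (traceMatrix Ψ).trace - qNum q k) • skewElem q (qNum q) (generator k R) k := by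
  have hid := (hR.isHeckeRep k).skewElem_mul_self hR.ne_zero (qNum_one _) (fun _ => rfl) k
    le_rfl hck
  obtain ⟨k, rfl⟩ := Nat.exists_eq_succ_of_ne_zero hk.ne'
  rw [← sites_skewElem q (qNum q) R (Nat.le_succ (k + 1)) (k + 1) le_rfl, partialTrace_mul_sites,
    partialTrace_sites_mul, partialTrace_sub, partialTrace_smul, partialTrace_smul,
    partialTrace_one]
  simp only [Nat.succ_eq_add_one, Nat.add_sub_cancel]
  rw [partialTrace_generator _ hΨ.sum_mul_traceMatrix, smul_smul, ← sub_smul, mul_smul_comm,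
    mul_one, smul_mul_assoc, hid]

/-- The partial trace of the vanishing numerator is (q^N Tr C - N_q) A^{(N)}, and A^{(N)} is not
zero since its trace is 1. -/
theorem IsSkewInverse.trace_traceMatrix (hR : IsHeckeSymmetry q R) (hΨ : IsSkewInverse R Ψ)
    (h : IsDeformationOfFlip q R) (hqk : ∀ k : ℕ, 2 ≤ k → k ≤ N → q ^ (2 * k) ≠ 1) :
    (traceMatrix Ψ).trace = (q ^ N)⁻¹ * qNum q N := by
  rcases Nat.eq_zero_or_pos N with rfl | hN
  · simp [qNum, Matrix.trace]
  have h1 := hΨ.partialTrace_skew hR hN fun j h2 hj =>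
    qNum_ne_zero hR.ne_zero (by omega) fun e => absurd e (hqk j h2 hj)
  rw [h.skewElem_mul_mul_skewElem hN hqk] at h1
  have h0 : partialTrace (traceMatrix Ψ) (0 : Matrix (Fin (N + 1) → Fin N) _ ℂ) = 0 := by
    ext a b
    simp [partialTrace_apply]
  rw [h0] at h1
  rcases smul_eq_zero.mp h1.symm with h2 | h2
  · rw [eq_inv_mul_iff_mul_eq₀ (pow_ne_zero _ hR.ne_zero)]
    linear_combination h2
  · have := h.trace_skewElem hqk
    rw [h2, Matrix.trace_zero] at this
    exact absurd this zero_ne_one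

theorem IsSkewInverse.trace_tensorPower_mul_skewElem_succ (hR : IsHeckeSymmetry q R)
    (hΨ : IsSkewInverse R Ψ) {k : ℕ} (hck : ∀ j, 2 ≤ j → j ≤ k → qNum q j ≠ 0) :
    (tensorPower (k + 1) (traceMatrix Ψ) *
        skewElem q (qNum q) (generator (k + 1) R) (k + 1)).trace =
      (qNum q (k + 1))⁻¹ * (q ^ k * (traceMatrix Ψ).trace - qNum q k) *
        (tensorPower k (traceMatrix Ψ) * skewElem q (qNum q) (generator k R) k).trace := by
  rcases Nat.eq_zero_or_pos k with rfl | hk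
  · rw [trace_tensorPower_succ_mul, show skewElem q (qNum q) (generator (0 + 1) R) (0 + 1) = 1 from
      rfl, partialTrace_one, qNum_one]
    simp [skewElem, qNum]
  have h1 := hΨ.partialTrace_skew hR hk hck
  rw [trace_tensorPower_succ_mul]
  obtain ⟨k, rfl⟩ := Nat.exists_eq_succ_of_ne_zero hk.ne'
  rw [skewElem, partialTrace_smul]
  simp only [Nat.succ_eq_add_one, Nat.add_sub_cancel] at h1 ⊢
  rw [h1, smul_smul, mul_smul_comm, Matrix.trace_smul, smul_eq_mul]

theorem IsSkewInverse.trace_tensorPower_mul_skewElem (hR : IsHeckeSymmetry q R)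
    (hΨ : IsSkewInverse R Ψ) (h : IsDeformationOfFlip q R) (hq : q ^ 2 ≠ 1)
    (hqk : ∀ k : ℕ, 2 ≤ k → k ≤ N → q ^ (2 * k) ≠ 1) :
    (tensorPower N (traceMatrix Ψ) * skewElem q (qNum q) (generator N R) N).trace =
      (q ^ (N * N))⁻¹ := by
  have h0 := hR.ne_zero
  have hne : ∀ j, j ≠ 0 → j ≤ N → qNum q j ≠ 0 := fun j h1 hj =>
    qNum_ne_zero h0 h1 fun e => by
      rcases Nat.lt_or_ge j 2 with h2 | h2
      · obtain rfl : j = 1 := by omega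
        exact absurd e hq
      · exact absurd e (hqk j h2 hj)
  -- The k-th step multiplies the trace by q^{-N} (N-k)_q / (k+1)_q. For k = N the two products of
  -- q-integers are the same up to order.
  have key : ∀ k ≤ N, (tensorPower k (traceMatrix Ψ) *
      skewElem q (qNum q) (generator k R) k).trace * ∏ j ∈ Finset.range k, qNum q (j + 1) =
        (q ^ (N * k))⁻¹ * ∏ j ∈ Finset.range k, qNum q (N - j) := by
    intro k hk
    induction k with
    | zero => simp [skewElem, Matrix.trace, tensorPower]
    | succ k ih =>
      have hk0 := hne (k + 1) (by omega) hk
      rw [hΨ.trace_tensorPower_mul_skewElem_succ hR fun j h2 hj => hne j (by omega) (by omega),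
        hΨ.trace_traceMatrix hR h hqk, qNum_sub h0 hq (by omega), Finset.prod_range_succ,
        Finset.prod_range_succ, mul_add, mul_one, pow_add, mul_inv]
      have ih := ih (by omega)
      generalize (tensorPower k (traceMatrix Ψ) *
        skewElem q (qNum q) (generator k R) k).trace = x at *
      field_simp at ih ⊢
      linear_combination qNum q (N - k) * ih
  have := key N le_rfl
  have e : ∏ j ∈ Finset.range N, qNum q (N - j) = ∏ j ∈ Finset.range N, qNum q (j + 1) := by
    rw [← Finset.prod_range_reflect]
    refine Finset.prod_congr rfl fun j hj => ?_
    have := Finset.mem_range.mp hj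
    congr 1
    omega
  rw [e] at this
  refine mul_right_cancel₀ (Finset.prod_ne_zero_iff.mpr fun j hj => ?_) this
  have := Finset.mem_range.mp hj
  exact hne _ (by omega) (by omega)

end TraceSkew

/-! ### Assembling the Capelli identity -/

section Final

theorem prod_ofFn_eq_incProd {E : Type*} [Ring E] (f : ℕ → E) (n : ℕ) :
    (List.ofFn fun k : Fin n => f k).prod = incProd f n := by
  induction n with
  | zero => rfl
  | succ n ih =>
    rw [List.ofFn_succ_last, List.prod_append, List.prod_singleton, incProd, ← ih]
    rfl

theorem prod_reverse_ofFn_eq_decProd {E : Type*} [Ring E] (f : ℕ → E) (n : ℕ) :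
    (List.ofFn fun k : Fin n => f k).reverse.prod = decProd f n := by
  induction n with
  | zero => rfl
  | succ n ih =>
    rw [List.ofFn_succ_last, List.reverse_append, List.prod_append, List.reverse_singleton,
      List.prod_singleton, decProd, ← ih]
    rfl

theorem map_skewElem {E F : Type*} [Ring E] [Algebra ℂ E] [Ring F] [Algebra ℂ F]
    (φ : E →ₐ[ℂ] F) (q : ℂ) (c : ℕ → ℂ) (T : ℕ → E) (k : ℕ) :
    φ (skewElem q c T k) = skewElem q c (fun i => φ (T i)) k := by
  induction k with
  | zero => exact map_one φ
  | succ k ih =>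
    cases k with
    | zero => exact map_one φ
    | succ k => simp only [skewElem, map_smul, map_mul, map_sub, map_one, ih]

variable {N n : ℕ} {𝒜 : Type*} [Ring 𝒜] [Algebra ℂ 𝒜]

theorem scalarMat_skewElem (q : ℂ) (c : ℕ → ℂ)
    (T : ℕ → Matrix (Fin n → Fin N) (Fin n → Fin N) ℂ) (k : ℕ) :
    scalarMat 𝒜 (skewElem q c T k) = skewElem q c (fun i => scalarMat 𝒜 (T i)) k :=
  map_skewElem (Algebra.ofId ℂ 𝒜).mapMatrix q c T k

theorem trace_scalarMat_mul_comm {ι : Type*} [Fintype ι] (X : Matrix ι ι ℂ) (Z : Matrix ι ι 𝒜) :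
    (scalarMat 𝒜 X * Z).trace = (Z * scalarMat 𝒜 X).trace := by
  simp only [Matrix.trace, Matrix.diag_apply, Matrix.mul_apply, scalarMat, Matrix.map_apply,
    Algebra.commutes]
  exact Finset.sum_comm

theorem vecMulVec_mul_mul_vecMulVec (u v : (Fin n → Fin N) → ℂ)
    (Y : Matrix (Fin n → Fin N) (Fin n → Fin N) 𝒜) (a b : Fin n → Fin N) :
    (scalarMat 𝒜 (Matrix.vecMulVec u v) * Y * scalarMat 𝒜 (Matrix.vecMulVec u v)) a b =
      (u a * v b) • sandwich v u Y := by
  simp only [Matrix.mul_apply, scalarMat, Matrix.map_apply, Matrix.vecMulVec_apply, sandwich,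
    Finset.smul_sum, Finset.sum_mul]
  rw [Finset.sum_comm]
  refine Finset.sum_congr rfl fun c _ => Finset.sum_congr rfl fun d _ => ?_
  rw [← Algebra.commutes, ← mul_assoc, ← map_mul, ← Algebra.smul_def, smul_smul]
  congr 1
  ring

variable {q : ℂ} {R Ψ : Matrix (Fin N × Fin N) (Fin N × Fin N) ℂ}

theorem exists_isDouble (hR : IsHeckeSymmetry q R) (n : ℕ) :
    ∃ m d : Matrix (Fin n → Fin N) (Fin n → Fin N) (QuantumDouble R),
      IsDouble n (generatorUnit (QuantumDouble R) n hR) m d ∧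
      (∀ k (hk : k < n), overlineCopy R (matM R) n k hk =
        copy (generatorUnit (QuantumDouble R) n hR) m k) ∧
      (∀ k (hk : k < n), overlineCopy R (matD R) n k hk =
        copy (generatorUnit (QuantumDouble R) n hR) d k) ∧
      ∀ k (hk : k < n), overlineCopy R (matL R) n k hk =
        copy (generatorUnit (QuantumDouble R) n hR) (m * d) k := by
  rcases Nat.eq_zero_or_pos n with rfl | hn
  -- With no tensor factors there is no first one to act in; every condition is then vacuous and any
  -- elements serve.
  · exact ⟨1, 1, ⟨⟨fun _ h => absurd h (by omega), fun _ _ _ h => absurd h (by omega)⟩,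
      fun _ _ h => absurd h (by omega), fun _ _ h => absurd h (by omega),
      fun h => absurd h (by omega), fun h => absurd h (by omega), fun h => absurd h (by omega)⟩,
      fun _ h => absurd h (by omega), fun _ h => absurd h (by omega),
      fun _ h => absurd h (by omega)⟩
  · refine ⟨oneSite ⟨0, hn⟩ (matM R), oneSite ⟨0, hn⟩ (matD R), isDouble_quantumDouble hR hn,
      fun k hk => overlineCopy_eq_copy hR _ k hk, fun k hk => overlineCopy_eq_copy hR _ k hk,
      fun k hk => ?_⟩
    rw [overlineCopy_eq_copy hR, matL, oneSite_mul]

theorem rTrace_skewElem_mul_capelliProduct (hR : IsHeckeSymmetry q R) (hΨ : IsSkewInverse R Ψ)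
    (hdef : IsDeformationOfFlip q R) (hq : q ^ 2 ≠ 1)
    (hqk : ∀ k : ℕ, 2 ≤ k → k ≤ N → q ^ (2 * k) ≠ 1) (u v : (Fin N → Fin N) → ℂ)
    (hA : skewElem q (qNum q) (generator N R) N = Matrix.vecMulVec u v) (huv : v ⬝ᵥ u = 1) :
    rTrace Ψ (scalarMat (QuantumDouble R) (skewElem q (qNum q) (generator N R) N) *
      capelliProduct q R) = (q ^ N)⁻¹ • (detM R u v * detD R u v) := by
  have h0 := hR.ne_zero
  have hck : ∀ j, 2 ≤ j → j ≤ N → qNum q j ≠ 0 := fun j h2 hj =>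
    qNum_ne_zero h0 (by omega) fun e => absurd e (hqk j h2 hj)
  obtain ⟨m, d, hD, hm, hd, hl⟩ := exists_isDouble hR N
  have hTr := hΨ.trace_tensorPower_mul_skewElem hR hdef hq hqk
  have hA2 := (hR.isHeckeRep N).skewElem_mul_self h0 (qNum_one q) (fun _ => rfl) N le_rfl hck
  have hTA := (hR.isHeckeRep N).mul_skewElem h0 (qNum_one q) (fun _ => rfl) N le_rfl hck
  have hCA : Commute (tensorPower N (traceMatrix Ψ)) (skewElem q (qNum q) (generator N R) N) :=
    commute_skewElem N fun i _ => commute_tensorPower_generator _ (hΨ.commute_traceMatrix hR) i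
  have hMA : Commute (incProd (copy (generatorUnit (QuantumDouble R) N hR) m) N)
      (scalarMat (QuantumDouble R) (skewElem q (qNum q) (generator N R) N)) := by
    rw [scalarMat_skewElem]
    exact commute_skewElem N fun i hi =>
      (commute_incProd hD.rep hD.comm_m hD.refl_m N i hi le_rfl (by omega)).symm
  set A := skewElem q (qNum q) (generator N R) N
  set T := generatorUnit (QuantumDouble R) N hR with hT
  have eM : detM R u v = sandwich v u (incProd (copy T m) N) := by
    rw [detM, ← prod_ofFn_eq_incProd]
    simp only [hm]
  have eD : detD R u v = sandwich v u (decProd (copy T d) N) := by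
    rw [detD, ← prod_reverse_ofFn_eq_decProd]
    simp only [hd]
  have eY : capelliProduct q R =
      incProd (fun j => copy T (m * d) j + (q ^ j * qNum q j) • 1) N := by
    rw [capelliProduct, ← prod_ofFn_eq_incProd, qInt_eq_qNum h0 hq]
    simp only [hl]
  have hcap := hD.capelli h0 (fun j => q ^ j * qNum q j) (by simp [qNum])
    (pow_mul_qNum_succ h0 hq) N le_rfl (scalarMat (QuantumDouble R) A) fun j hj => by
      rw [hT, val_generatorUnit, ← scalarMat_mul, hTA j hj, scalarMat_smul]
  rw [← eY] at hcap
  set Y := capelliProduct q R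
  set Mp := incProd (copy T m) N
  set Dp := decProd (copy T d) N
  set A' := scalarMat (QuantumDouble R) A with hA'
  set K := scalarMat (QuantumDouble R) (tensorPower N (traceMatrix Ψ)) with hK
  have hA2' : A' * A' = A' := by rw [hA', ← scalarMat_mul, hA2]
  have hKA : K * A' = A' * K := by rw [hA', hK, ← scalarMat_mul, hCA.eq, scalarMat_mul]
  have hAMDA : A' * (Mp * Dp * A') =
      Matrix.of fun a b => (u a * v b) • (detM R u v * detD R u v) := by
    -- Idempotency and the commutation with `Mp` insert copies of `A'` between the two products,
    -- which separates the determinants.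
    have : A' * (Mp * Dp * A') = (A' * Mp * A') * (A' * Dp * A') := by
      calc _ = (A' * A') * Mp * Dp * A' := by rw [hA2']; simp only [mul_assoc]
        _ = A' * (A' * Mp) * Dp * A' := by simp only [mul_assoc]
        _ = A' * (Mp * A') * Dp * A' := by rw [hMA.eq]
        _ = A' * (Mp * (A' * A')) * Dp * A' := by rw [hA2']
        _ = _ := by simp only [mul_assoc]
    rw [this]
    ext a b
    rw [hA', hA, Matrix.mul_apply]
    simp only [vecMulVec_mul_mul_vecMulVec, ← eM, ← eD, Matrix.of_apply, smul_mul_smul_comm,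
      ← Finset.sum_smul]
    congr 1
    calc _ = u a * v b * (v ⬝ᵥ u) := by
          rw [dotProduct, Finset.mul_sum]
          exact Finset.sum_congr rfl fun c _ => by ring
      _ = _ := by rw [huv, mul_one]
  have hfin : (K * Matrix.of fun a b => (u a * v b) • (detM R u v * detD R u v)).trace =
      (q ^ (N * N))⁻¹ • (detM R u v * detD R u v) := by
    rw [← hTr, hA, hK]
    simp only [Matrix.trace, Matrix.diag_apply, Matrix.mul_apply, scalarMat, Matrix.map_apply,
      Matrix.of_apply, ← Algebra.smul_def, smul_smul, Finset.sum_smul, Matrix.vecMulVec_apply]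
  -- One factor `A'` is split off and cycled to the right of `Y`, where the matrix identity applies.
  -- Cyclicity is available over the noncommutative algebra because `A'` has scalar entries.
  calc (K * (A' * Y)).trace = (A' * (K * (A' * Y))).trace := by
        nth_rewrite 1 [← hA2']
        rw [mul_assoc, ← mul_assoc, hKA, mul_assoc]
    _ = (K * (A' * (Y * A'))).trace := by
        rw [hA', trace_scalarMat_mul_comm]
        simp only [mul_assoc]
    _ = _ := by
        rw [hcap, mul_smul_comm, mul_smul_comm, hAMDA, Matrix.trace_smul, hfin, smul_smul]
        congr 1
        have : N * N = N * (N - 1) + N := by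
          cases N with
          | zero => rfl
          | succ N => simp; ring
        rw [this, pow_add]
        field_simp

end Final

end Capelli

theorem corollary6 (N : ℕ) (q : ℂ) (hq : q ^ 2 ≠ 1)
    (hqk : ∀ k : ℕ, 2 ≤ k → k ≤ N → q ^ (2 * k) ≠ 1)
    (R Ψ : Matrix (Fin N × Fin N) (Fin N × Fin N) ℂ)
    (hR : Capelli.IsHeckeSymmetry q R)
    (hΨ : Capelli.IsSkewInverse R Ψ)
    (hdef : Capelli.IsDeformationOfFlip q R) :
    (Capelli.skewSymm q R N N le_rfl).rank = 1 ∧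
    (∃ u v : (Fin N → Fin N) → ℂ,
      Capelli.skewSymm q R N N le_rfl = Matrix.vecMulVec u v ∧ v ⬝ᵥ u = 1) ∧
    ∀ u v : (Fin N → Fin N) → ℂ,
      Capelli.skewSymm q R N N le_rfl = Matrix.vecMulVec u v → v ⬝ᵥ u = 1 →
      Capelli.rTrace Ψ
          (Capelli.scalarMat (Capelli.QuantumDouble R) (Capelli.skewSymm q R N N le_rfl) *
            Capelli.capelliProduct q R) =
        (q ^ N)⁻¹ • (Capelli.detM R u v * Capelli.detD R u v) := by
  have h0 := hR.ne_zero
  have hA2 := (hR.isHeckeRep N).skewElem_mul_self h0 (Capelli.qNum_one q) (fun _ => rfl) N le_rfl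
    fun j h2 hj => Capelli.qNum_ne_zero h0 (by omega) fun e => absurd e (hqk j h2 hj)
  have htr := hdef.trace_skewElem hqk
  rw [Capelli.skewSymm_eq_skewElem, Capelli.qInt_eq_qNum h0 hq]
  have hrank : (Capelli.skewElem q (Capelli.qNum q) (Capelli.generator N R) N).rank = 1 := by
    have := Capelli.trace_eq_rank_of_mul_self hA2
    rw [htr] at this
    exact_mod_cast this.symm
  refine ⟨hrank, ?_, fun u v hA huv =>
    Capelli.rTrace_skewElem_mul_capelliProduct hR hΨ hdef hq hqk u v hA huv⟩
  obtain ⟨u, v, hA⟩ := Capelli.exists_eq_vecMulVec_of_rank_eq_one hrank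
  refine ⟨u, v, hA, ?_⟩
  -- The normalization needs no rescaling of the vectors: their pairing is the trace of A^{(N)}.
  rw [hA, Matrix.trace_vecMulVec, dotProduct_comm] at htr
  exact htr
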